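/- **Setting.** Let $q$ be a prime power and $n\ge 1$. Write points of $\mathrm{PG}(2,q^n)$ as $(a,b,c)_{\mathbb F_{q^n}}$ and let $l_\infty$ be the line $c=0$. Write points of $\mathrm{PG}(2n,q)$ as $(a,b,c)_{\mathbb F_q}$ with $a,b\in\mathbb F_{q^n}$, $c\in\mathbb F_q$, and let $H_\infty$ be the hyperplane $c=0$. The ABB-map $\phi$ sends $(a,b,1)_{\mathbb F_{q^n}}$ to the point $(a,b,1)_{\mathbb F_q}$ and $(a,b,0)_{\mathbb F_{q^n}}$ to the spread element $\{(ax,bx,0)_{\mathbb F_q}: x\in\mathbb F_{q^n}^*\}$; the ABB-representation of a point set is the union of the images of its points. For $k\mid n$, let $$\mathcal D_k=\bigl\{\{(ax,bx,0)_{\mathbb F_q}:x\in\mathbb F_{q^k}^*\}: a,b\in\mathbb F_{q^n},\ (a,b)\ne(0,0)\bigr\}.$$ Embed $\mathrm{PG}(2n,q)$ in $\mathrm{PG}(2n,q^n)$ by $\iota:(a,b,c)_{\mathbb F_q}\mapsto(a,a^q,\dots,a^{q^{n-1}};b,b^q,\dots,b^{q^{n-1}};c)_{\mathbb F_{q^n}}$,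 let $\sigma$ be the collineation $$(a_0,\dots,a_{n-1};b_0,\dots,b_{n-1};c)\mapsto(a_{n-1}^q,a_0^q,\dots,a_{n-2}^q;b_{n-1}^q,b_0^q,\dots,b_{n-2}^q;c^q),$$ and let $\nu$ be the line spanned by the two points whose only nonzero coordinate is $a_0$, respectively $b_0$. For $k\mid n$ put $\Pi=\langle\nu,\nu^{\sigma^k},\nu^{\sigma^{2k}},\dots,\nu^{\sigma^{n-k}}\rangle\cap\mathrm{Fix}(\sigma^k)$; the indicator set of $\mathcal D_k$ is $\{\Pi,\Pi^\sigma,\dots,\Pi^{\sigma^{k-1}}\}$. A normal rational curve of degree $k$ in $\mathrm{PG}(N,Q)$, where $2\le k\le Q$, is a set $\{(s^ke_0+s^{k-1}te_1+\dots+t^ke_k)_{\mathbb F_Q}: s,t\in\mathbb F_Q,\ (s,t)\ne(0,0)\}$ with $e_0,\dots,e_k$ linearly independent. An $\mathbb F_{q^n}$-extension of a normal rational curve $\mathcal C$ of degree $k$ in $\mathrm{PG}(2n,q)$ is a normal rational curve $\mathcal C^*$ of degree $k$ in $\mathrm{PG}(2n,q^n)$ containing $\iota(\mathcal C)$ (it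 is unique when $k+2\le q$). For vectors $u,v$ of $\mathbb F_{q^n}^3$ linearly independent over $\mathbb F_{q^n}$ and a subfield $L$ of $\mathbb F_{q^n}$, the set $\{(su+tv)_{\mathbb F_{q^n}}: s,t\in L,\ (s,t)\neq(0,0)\}$ is an $L$-subline. A subline is external to $l_\infty$ if it has no point on $l_\infty$, and tangent to $l_\infty$ if it has exactly one. **Theorem 2.6.** Assume $q\ge n$. A set $\mathcal C$ of points of $\mathrm{PG}(2n,q)$ is the ABB-representation of an $\mathbb F_q$-subline $m$ of $\mathrm{PG}(2,q^n)$ external to $l_\infty$ if and only if there is a divisor $k$ of $n$ such that (i) $\mathcal C$ is a normal rational curve of degree $k$ (so $k\ge2$) contained in a $k$-space that meets $H_\infty$ in an element of $\mathcal D_k$, and (ii) $\mathcal C$ has an $\mathbb F_{q^n}$-extension $\mathcal C^*$ whose intersection with $\Pi\cup\Pi^\sigma\cup\dots\cup\Pi^{\sigma^{k-1}}$ consists of $k$ distinct conjugate points $Q,Q^\sigma,\dots,Q^{\sigma^{k-1}}$. Moreover, if $m$ is an $\mathbb F_q$-subline external to $l_\infty$ and $k\mid n$ is such that (i) and (ii)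 hold for the ABB-representation of $m$, then among all sublines containing $m$ and tangent to $l_\infty$ there is a unique one with the smallest number of points, and it is an $\mathbb F_{q^k}$-subline. -/

import Mathlib

open scoped LinearAlgebra.Projectivization

noncomputable section

namespace ABB

/-! Throughout, `F` is the field with `q` elements and `K` its extension of degree `n`. -/

/-- `P = (v)_k`: the point `P` of `PG(V)` is defined by the vector `v`
(never true for `v = 0`). -/
def IsPt {k V : Type*} [Field k] [AddCommGroup V] [Module k V] (v : V) (P : ℙ k V) : Prop :=
  P.submodule = Submodule.span k {v}

section NormalRationalCurves

variable (k : Type*) {V : Type*} [Field k] [AddCommGroup V] [Module k V]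

/-- `C` is a normal rational curve of degree `d`, where `2 ≤ d ≤ |k|`:
`C = {(s ^ d e₀ + s ^ (d - 1) t e₁ + ⋯ + t ^ d e_d)_k}` with `e₀, …, e_d` linearly independent. -/
def IsNRC (d : ℕ) (C : Set (ℙ k V)) : Prop :=
  2 ≤ d ∧ d ≤ Nat.card k ∧ ∃ e : Fin (d + 1) → V, LinearIndependent k e ∧
    C = {P | ∃ s t : k, IsPt (∑ i : Fin (d + 1), (s ^ (d - (i : ℕ)) * t ^ (i : ℕ)) • e i) P}

/-- The point set of the projective subspace defined by a vector subspace. -/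
def pts (W : Submodule k V) : Set (ℙ k V) := {P | P.submodule ≤ W}

end NormalRationalCurves

section Plane

variable (K : Type*) [Field K]

/-- The points of the projective plane over `K`. -/
abbrev Plane := ℙ K (K × K × K)

/-- The line at infinity `c = 0` of the projective plane over `K`. -/
def lInf : Set (Plane K) := {P | ∃ a b : K, IsPt ((a, b, 0) : K × K × K) P}

/-- `m` is a subline of order `Q` of the projective plane over `K`: the points of a line having
coordinates in the subfield `L` with `Q` elements, for suitable coordinates on that line. -/
def IsSubline (Q : ℕ) (m : Set (Plane K)) : Prop :=
  ∃ L : Subfield K, Nat.card L = Q ∧ ∃ u v : K × K × K, LinearIndependent K ![u, v] ∧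
    m = {P | ∃ s ∈ L, ∃ t ∈ L, IsPt (s • u + t • v) P}

variable {K}

/-- `m` has no point on the line at infinity. -/
def External (m : Set (Plane K)) : Prop := m ∩ lInf K = ∅

/-- `m` has exactly one point on the line at infinity. -/
def Tangent (m : Set (Plane K)) : Prop := (m ∩ lInf K).ncard = 1

/-- `m'` is a subline (of some order) that contains `m` and is tangent to the line at infinity. -/
def IsTangentSublineOver (m m' : Set (Plane K)) : Prop :=
  (∃ Q, IsSubline K Q m') ∧ m ⊆ m' ∧ Tangent m'

/-- `m'` is the smallest subline (the one with the smallest number of points) that contains `m` and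
is tangent to the line at infinity. -/
def IsSmallestTangentSubline (m m' : Set (Plane K)) : Prop :=
  IsTangentSublineOver m m' ∧
    ∀ m'', IsTangentSublineOver m m'' → m'' ≠ m' → m'.ncard < m''.ncard

end Plane

section Representation

variable (F K : Type*) [Field F] [Fintype F] [Field K] [Algebra F K]

/-- The points of `Σ = PG(2n, q)`, written `(a, b, c)_F` with `a, b ∈ K` and `c ∈ F`. -/
abbrev Sig := ℙ F (K × K × F)

/-- The hyperplane at infinity `c = 0` of `Σ`. -/
def hInf : Set (Sig F K) := {R | ∃ a b : K, IsPt ((a, b, 0) : K × K × F) R}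

/-- The ABB-map: `(a, b, 1)_K` goes to the point `(a, b, 1)_F`, and `(a, b, 0)_K` goes to the spread
element `{(a x, b x, 0)_F | x ∈ K, x ≠ 0}`. -/
def abb (P : Plane K) : Set (Sig F K) :=
  {R | ∃ a b : K,
    (IsPt ((a, b, 1) : K × K × K) P ∧ IsPt ((a, b, 1) : K × K × F) R) ∨
    (IsPt ((a, b, 0) : K × K × K) P ∧
      ∃ x : K, x ≠ 0 ∧ IsPt ((a * x, b * x, 0) : K × K × F) R)}

/-- The ABB-representation of a set of points of the plane. -/
def abbImage (m : Set (Plane K)) : Set (Sig F K) := ⋃ P ∈ m, abb F K P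

/-- The subspread `𝒟_k`: its elements are `{(a x, b x, 0)_F | x ∈ 𝔽_{q^k}, x ≠ 0}` with
`(a, b) ≠ (0, 0)`. It is used for `k ∣ n`, when `𝔽_{q^k} = {x ∈ K | x ^ (q ^ k) = x}`. -/
def subspread (k : ℕ) : Set (Set (Sig F K)) :=
  {E | ∃ a b : K, (a, b) ≠ (0, 0) ∧
    E = {R | ∃ x : K, x ^ (Fintype.card F ^ k) = x ∧ x ≠ 0 ∧
      IsPt ((a * x, b * x, 0) : K × K × F) R}}

variable (n : ℕ)

/-- Coordinate vectors `(a₀, …, a_{n-1}; b₀, …, b_{n-1}; c)` of `Σ* = PG(2n, q^n)`. -/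
abbrev VStar := (Fin n → K) × (Fin n → K) × K

/-- The points of `Σ* = PG(2n, q^n)`. -/
abbrev SigStar := ℙ K (VStar K n)

variable {K}

theorem add_pow_q (i : ℕ) (x y : K) :
    (x + y) ^ (Fintype.card F ^ i) = x ^ (Fintype.card F ^ i) + y ^ (Fintype.card F ^ i) := by
  induction i with
  | zero => simp
  | succ i ih =>
    have h := map_add (FiniteField.frobeniusAlgHom F K)
    simp only [FiniteField.coe_frobeniusAlgHom] at h
    rw [pow_succ, pow_mul, pow_mul, pow_mul, ih, h]

theorem algebraMap_pow_q (i : ℕ) (c : F) :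
    (algebraMap F K c) ^ (Fintype.card F ^ i) = algebraMap F K c := by
  rw [← map_pow, FiniteField.pow_card_pow]

variable (K)

/-- The embedding `(a, b, c) ↦ (a, a^q, …, a^{q^{n-1}}; b, b^q, …, b^{q^{n-1}}; c)` on vectors. -/
def iotaVec : (K × K × F) →ₛₗ[algebraMap F K] VStar K n where
  toFun v := (fun i => v.1 ^ (Fintype.card F ^ (i : ℕ)),
    fun i => v.2.1 ^ (Fintype.card F ^ (i : ℕ)), algebraMap F K v.2.2)
  map_add' v w := by
    ext <;> simp [add_pow_q]
  map_smul' r v := by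
    ext <;> simp [Algebra.smul_def, mul_pow, algebraMap_pow_q]

variable [NeZero n]

theorem iotaVec_injective : Function.Injective (iotaVec F K n) := by
  intro v w h
  have h1 := congrFun (congrArg Prod.fst h) 0
  have h2 := congrFun (congrArg (fun z => z.2.1) h) 0
  have h3 := congrArg (fun z => z.2.2) h
  simp only [iotaVec, LinearMap.coe_mk, AddHom.coe_mk, Fin.coe_ofNat_eq_mod, Nat.zero_mod,
    pow_zero, pow_one] at h1 h2 h3
  exact Prod.ext h1 (Prod.ext h2 ((algebraMap F K).injective h3))

/-- The embedding `ι` of `Σ = PG(2n, q)` in `Σ* = PG(2n, q^n)` as a subgeometry. -/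
def iota : Sig F K → SigStar K n := Projectivization.map (iotaVec F K n) (iotaVec_injective F K n)

/-- The semilinear map `(a₀, …, a_{n-1}; b₀, …, b_{n-1}; c) ↦
(a_{n-1}^q, a₀^q, …, a_{n-2}^q; b_{n-1}^q, b₀^q, …, b_{n-2}^q; c^q)`; the indices are cyclic. -/
def sigmaVec : VStar K n →ₛₗ[(FiniteField.frobeniusAlgHom F K : K →+* K)] VStar K n where
  toFun v := (fun i => v.1 (i - 1) ^ Fintype.card F, fun i => v.2.1 (i - 1) ^ Fintype.card F,
    v.2.2 ^ Fintype.card F)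
  map_add' v w := by
    have h := add_pow_q F (K := K) 1
    simp only [pow_one] at h
    ext <;> simp [h]
  map_smul' r v := by
    ext <;> simp [mul_pow]

theorem sigmaVec_injective : Function.Injective (sigmaVec F K n) := by
  have hq : Function.Injective (fun x : K => x ^ Fintype.card F) := by
    rw [← FiniteField.coe_frobeniusAlgHom F K]
    exact (FiniteField.frobeniusAlgHom F K : K →+* K).injective
  intro v w h
  have h1 := fun i => congrFun (congrArg Prod.fst h) i
  have h2 := fun i => congrFun (congrArg (fun z => z.2.1) h) i
  have h3 := congrArg (fun z => z.2.2) h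
  refine Prod.ext (funext fun i => ?_) (Prod.ext (funext fun i => ?_) (hq h3))
  · have := h1 (i + 1)
    simp only [sigmaVec, LinearMap.coe_mk, AddHom.coe_mk, add_sub_cancel_right] at this
    exact hq this
  · have := h2 (i + 1)
    simp only [sigmaVec, LinearMap.coe_mk, AddHom.coe_mk, add_sub_cancel_right] at this
    exact hq this

/-- The collineation `σ` of `Σ*`; the points `Q, Q^σ, Q^{σ^2}, …` are called conjugate. -/
def sigma : SigStar K n → SigStar K n :=
  Projectivization.map (sigmaVec F K n) (sigmaVec_injective F K n)

/-- The line `ν` (as a subspace of vectors), spanned by `(1, 0, …, 0; 0, …, 0; 0)` and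
`(0, …, 0; 1, 0, …, 0; 0)`. -/
def nu : Submodule K (VStar K n) :=
  Submodule.span K {(Pi.single 0 1, 0, 0), (0, Pi.single 0 1, 0)}

/-- `Π = ⟨ν, ν^{σ^k}, …, ν^{σ^{n-k}}⟩ ∩ Fix(σ^k)`, for `k ∣ n`. -/
def indicatorSpace (k : ℕ) : Set (SigStar K n) :=
  pts K (Submodule.span K
    {w | ∃ r < n / k, ∃ v ∈ nu K n, w = (sigmaVec F K n)^[k * r] v}) ∩
    {R | (sigma F K n)^[k] R = R}

/-- All points lying on some element of the indicator set `{Π, Π^σ, …, Π^{σ^{k-1}}}` of `𝒟_k`. -/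
def indicatorPoints (k : ℕ) : Set (SigStar K n) :=
  ⋃ j ∈ Set.Iio k, (sigma F K n)^[j] '' indicatorSpace F K n k

/-- `Cs` is an `𝔽_{q^n}`-extension of the normal rational curve `C` of degree `k`: a normal
rational curve of degree `k` over `K` that contains the points of `C`. -/
def IsExtension (k : ℕ) (C : Set (Sig F K)) (Cs : Set (SigStar K n)) : Prop :=
  IsNRC K k Cs ∧ iota F K n '' C ⊆ Cs

/-- `C` is a normal rational curve of degree `k` contained in a `k`-space that meets the hyperplane
at infinity in an element of `𝒟_k`. -/
def CondI (k : ℕ) (C : Set (Sig F K)) : Prop :=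
  IsNRC F k C ∧ ∃ W : Submodule F (K × K × F), Module.finrank F W = k + 1 ∧ C ⊆ pts F W ∧
    pts F W ∩ hInf F K ∈ subspread F K k

/-- The extension of `C` meets the indicator set of `𝒟_k` in `k` (distinct) conjugate points
`Q, Q^σ, …, Q^{σ^{k-1}}`. -/
def CondII (k : ℕ) (C : Set (Sig F K)) : Prop :=
  ∃ Cs : Set (SigStar K n), IsExtension F K n k C Cs ∧
    ∃ Q : SigStar K n, Set.InjOn (fun j => (sigma F K n)^[j] Q) (Set.Iio k) ∧
      Cs ∩ indicatorPoints F K n k = (fun j => (sigma F K n)^[j] Q) '' Set.Iio k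

end Representation

end ABB

end

/-!
In affine coordinates an `𝔽_q`-subline external to `l_∞` is `{v} ∪ {v + (t - θ)⁻¹ w : t ∈ 𝔽_q}` with
`w ≠ 0` and `θ ∉ 𝔽_q`. Let `f` be the minimal polynomial of `θ` over `𝔽_q` and `k` its degree.
Multiplying by `f(t)` turns this into a parametrization by polynomials of degree at most `k`, with
coefficients taken from `f` and `f / (X - θ)`. So the representation is a normal rational curve; it
lies in `⟨(v, 1), 𝔽_q(θ) w⟩`, whose part at infinity is an element of `𝒟_k`. Over `𝔽_{q^n}` its
points at infinity have the roots `θ^{q^j}` of `f` as parameters, and they are conjugate points of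
the indicator set. The smallest tangent subline is the one over `𝔽_q(θ) = 𝔽_{q^k}`.

Conversely, `𝒟_k` puts the curve on the points `v + y w` with `y ∈ 𝔽_{q^k}`, where `v` may be chosen
on the curve. For each `i`, there is a linear functional with value `y^{q^i}` at the point
`v + y w`. Along the extended curve it is a binary form of degree `k` in the parameter, as is the
last coordinate, and by the position of the conjugate points the two share `k - 1` zeros. So
`y^{-q^i}` is a fractional linear function of the parameter, with its pole at the parameter of `v`;
comparing `i = 0` with `i = 1` shows that `Y = y⁻¹` satisfies `Y^q = A Y + B` with constants `A` and
`B`. The solutions of this equation form an affine line over `𝔽_q`.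
-/

noncomputable section

namespace ABB

section Points

variable {k V : Type*} [Field k] [AddCommGroup V] [Module k V]

theorem isPt_mk {v : V} (hv : v ≠ 0) : IsPt v (Projectivization.mk k v hv) := by
  rw [IsPt, Projectivization.submodule_mk]

theorem exists_isPt (P : ℙ k V) : ∃ v : V, IsPt v P :=
  ⟨P.rep, P.submodule_eq⟩

theorem IsPt.ne_zero {v : V} {P : ℙ k V} (h : IsPt v P) : v ≠ 0 := by
  rintro rfl
  have h1 := P.finrank_submodule
  rw [h, Submodule.span_zero_singleton, finrank_bot] at h1
  exact zero_ne_one h1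

theorem IsPt.unique {v : V} {P P' : ℙ k V} (h : IsPt v P) (h' : IsPt v P') : P = P' :=
  Projectivization.submodule_injective (h.trans h'.symm)

theorem IsPt.eq_mk {v : V} {P : ℙ k V} (h : IsPt v P) : P = Projectivization.mk k v h.ne_zero :=
  h.unique (isPt_mk _)

theorem isPt_smul_iff {c : k} (hc : c ≠ 0) {v : V} {P : ℙ k V} : IsPt (c • v) P ↔ IsPt v P := by
  rw [IsPt, IsPt, Submodule.span_singleton_smul_eq (IsUnit.mk0 c hc)]

theorem IsPt.of_smul {c : k} {v : V} {P : ℙ k V} (h : IsPt (c • v) P) : IsPt v P :=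
  (isPt_smul_iff (left_ne_zero_of_smul h.ne_zero)).1 h

theorem IsPt.iff_exists_smul {v w : V} {P : ℙ k V} (h : IsPt v P) :
    IsPt w P ↔ ∃ c : k, c ≠ 0 ∧ w = c • v := by
  constructor
  · intro h'
    obtain ⟨a, rfl⟩ := (Projectivization.mk_eq_mk_iff k w v h'.ne_zero h.ne_zero).1
      (h'.eq_mk.symm.trans h.eq_mk)
    exact ⟨a, a.ne_zero, rfl⟩
  · rintro ⟨c, hc, rfl⟩
    exact (isPt_smul_iff hc).2 h

theorem IsPt.mem_pts_iff {v : V} {P : ℙ k V} (h : IsPt v P) (W : Submodule k V) :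
    P ∈ pts k W ↔ v ∈ W := by
  rw [pts, Set.mem_ofPred_eq, h, Submodule.span_singleton_le_iff_mem]

theorem IsPt.map {k' V' : Type*} [Field k'] [AddCommGroup V'] [Module k' V'] {τ : k →+* k'}
    (f : V →ₛₗ[τ] V') (hf : Function.Injective f) {v : V} {P : ℙ k V} (h : IsPt v P) :
    IsPt (f v) (Projectivization.map f hf P) := by
  rw [h.eq_mk, Projectivization.map_mk]
  exact isPt_mk _

end Points

section BinaryForms

variable {k V : Type*} [Field k] [AddCommGroup V] [Module k V]

/-- The Veronese map of degree `d` of the projective line, on coordinate vectors. -/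
def veronese (d : ℕ) (p : k × k) : Fin (d + 1) → k :=
  fun i => p.1 ^ (d - (i : ℕ)) * p.2 ^ (i : ℕ)

theorem veronese_smul (d : ℕ) (c : k) (p : k × k) : veronese d (c • p) = c ^ d • veronese d p := by
  ext i
  have h : c ^ d = c ^ (d - (i : ℕ)) * c ^ (i : ℕ) := by
    rw [← pow_add, Nat.sub_add_cancel (Nat.lt_succ_iff.1 i.2)]
  simp only [veronese, Prod.smul_fst, Prod.smul_snd, Pi.smul_apply, smul_eq_mul, mul_pow, h]
  ring

theorem veronese_zero_one (d : ℕ) :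
    veronese d ((0, 1) : k × k) = Pi.single (Fin.last d) 1 := by
  ext i
  obtain rfl | hi := eq_or_ne i (Fin.last d)
  · simp [veronese]
  · have : d - (i : ℕ) ≠ 0 := Nat.sub_ne_zero_of_lt (Fin.val_lt_last hi)
    simp [veronese, hi, zero_pow this]

/-- The determinant of two coordinate vectors on the projective line; it vanishes if and only if
they define the same point. -/
def cross (p p' : k × k) : k := p.1 * p'.2 - p'.1 * p.2

theorem cross_self (p : k × k) : cross p p = 0 := sub_self _

theorem cross_swap (p p' : k × k) : cross p' p = -cross p p' := (neg_sub _ _).symm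

theorem exists_smul_of_cross_eq_zero {p p' : k × k} (hp : p ≠ 0) (h : cross p p' = 0) :
    ∃ c : k, p' = c • p := by
  have h : p.1 * p'.2 = p'.1 * p.2 := sub_eq_zero.1 h
  by_cases h1 : p.1 = 0
  · have h2 : p.2 ≠ 0 := fun h2 => hp (Prod.ext h1 h2)
    have h1' : p'.1 = 0 := by
      rw [h1, zero_mul] at h
      exact (mul_eq_zero.1 h.symm).resolve_right h2
    exact ⟨p'.2 / p.2, Prod.ext (by simp [h1, h1']) (by simp [h2])⟩
  · refine ⟨p'.1 / p.1, Prod.ext (by simp [h1]) ?_⟩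
    rw [Prod.smul_snd, smul_eq_mul, div_mul_eq_mul_div, ← h, mul_div_cancel_left₀ _ h1]

variable (k) in
/-- The binary forms of degree `d`, as functions of the pair of variables. -/
def binaryForms (d : ℕ) : Submodule k (k × k → k) :=
  Submodule.span k (Set.range fun i p => veronese d p i)

theorem mem_binaryForms_iff {d : ℕ} {G : k × k → k} :
    G ∈ binaryForms k d ↔ ∃ g : Fin (d + 1) → k, ∀ p, ∑ i, g i * veronese d p i = G p := by
  simp only [binaryForms, Submodule.mem_span_range_iff_exists_fun, funext_iff, Finset.sum_apply,
    Pi.smul_apply, smul_eq_mul]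

theorem coeff_eq_zero_of_forall_sum_eq_zero {d : ℕ} {g : Fin (d + 1) → k} {p : Fin (d + 1) → k × k}
    (hp : Pairwise fun i j => cross (p i) (p j) ≠ 0)
    (h : ∀ j, ∑ i, g i * veronese d (p j) i = 0) : g = 0 := by
  let M := Matrix.projVandermonde (fun j => (p j).2) fun j => (p j).1
  have hdet : M.det ≠ 0 := by
    simp only [M, Matrix.det_projVandermonde, Finset.prod_ne_zero_iff, Finset.mem_Ioi]
    intro i _ j hij
    simpa only [cross, mul_comm] using hp hij.ne
  refine Matrix.eq_zero_of_mulVec_eq_zero hdet (funext fun j => (h j).symm.trans ?_ |>.symm)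
  refine Finset.sum_congr rfl fun i _ => ?_
  simp only [M, Matrix.projVandermonde_apply, veronese, Fin.val_rev, Nat.add_sub_add_right]
  ring

theorem eq_zero_of_mem_binaryForms {d : ℕ} {G : k × k → k} (hG : G ∈ binaryForms k d)
    {p : Fin (d + 1) → k × k} (hp : Pairwise fun i j => cross (p i) (p j) ≠ 0)
    (h : ∀ j, G (p j) = 0) : G = 0 := by
  obtain ⟨g, hg⟩ := mem_binaryForms_iff.1 hG
  ext p'
  rw [← hg, coeff_eq_zero_of_forall_sum_eq_zero hp fun j => (hg _).trans (h j)]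
  simp

theorem cross_mul_mem_binaryForms {d : ℕ} (r : k × k) {G : k × k → k} (hG : G ∈ binaryForms k d) :
    (fun p => cross p r * G p) ∈ binaryForms k (d + 1) := by
  have mem (i) : (fun p => veronese (d + 1) p i) ∈ binaryForms k (d + 1) :=
    Submodule.subset_span ⟨i, rfl⟩
  suffices binaryForms k d ≤ (binaryForms k (d + 1)).comap
    (LinearMap.mulLeft k fun p => cross p r) from this hG
  rw [binaryForms, Submodule.span_le, Set.range_subset_iff]
  intro i
  refine Eq.subst (motive := (· ∈ binaryForms k (d + 1))) (funext fun p => ?_)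
    (Submodule.sub_mem _ (Submodule.smul_mem _ r.2 (mem i.castSucc))
      (Submodule.smul_mem _ r.1 (mem i.succ)))
  have h : d + 1 - (i : ℕ) = d - i + 1 := by omega
  simp only [LinearMap.mulLeft_apply, Pi.mul_apply, Pi.sub_apply, Pi.smul_apply, smul_eq_mul,
    veronese, cross, Fin.val_castSucc, Fin.val_succ, h, Nat.add_sub_add_right]
  ring

theorem prod_cross_mem_binaryForms {d : ℕ} (r : Fin d → k × k) :
    (fun p => ∏ i, cross p (r i)) ∈ binaryForms k d := by
  induction d with
  | zero => exact Submodule.subset_span ⟨0, by ext; simp [veronese]⟩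
  | succ d ih =>
    simp only [Fin.prod_univ_succ]
    exact cross_mul_mem_binaryForms _ (ih _)

/-- A binary form of degree `d` with `d` known zeros is a multiple of the product of the
corresponding linear forms; the factor is read off at the further point `p₀`. -/
theorem mul_prod_cross_eq {d : ℕ} {G : k × k → k} (hG : G ∈ binaryForms k d) {r : Fin d → k × k}
    (hr : Pairwise fun i j => cross (r i) (r j) ≠ 0) (h : ∀ i, G (r i) = 0) {p₀ : k × k}
    (hp₀ : ∀ i, cross p₀ (r i) ≠ 0) (p : k × k) :
    G p * ∏ i, cross p₀ (r i) = G p₀ * ∏ i, cross p (r i) := by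
  have hform := Submodule.sub_mem _ (Submodule.smul_mem _ (∏ i, cross p₀ (r i)) hG)
    (Submodule.smul_mem _ (G p₀) (prod_cross_mem_binaryForms r))
  let r' : Fin (d + 1) → k × k := Fin.cons p₀ r
  have hpair : Pairwise fun i j => cross (r' i) (r' j) ≠ 0 := by
    intro i j hij
    cases i using Fin.cases <;> cases j using Fin.cases
    · exact absurd rfl hij
    · exact hp₀ _
    · simpa [r', cross_swap p₀] using hp₀ _
    · exact hr fun h => hij (congrArg Fin.succ h)
  have hzero := eq_zero_of_mem_binaryForms hform hpair fun j => by
    cases j using Fin.cases with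
    | zero => simp [r', mul_comm]
    | succ j =>
      have hj : ∏ i, cross (r j) (r i) = 0 :=
        Finset.prod_eq_zero (Finset.mem_univ j) (cross_self (r j))
      simp [r', h, hj]
  have := congrFun hzero p
  simp only [Pi.sub_apply, Pi.smul_apply, smul_eq_mul, Pi.zero_apply] at this
  linear_combination this

theorem pairwise_cross_update {d : ℕ} {r : Fin d → k × k}
    (hr : Pairwise fun i j => cross (r i) (r j) ≠ 0) (j : Fin d) {p : k × k}
    (hp : ∀ i, cross p (r i) ≠ 0) :
    Pairwise fun i i' => cross (Function.update r j p i) (Function.update r j p i') ≠ 0 := by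
  intro i i' hii'
  simp only [Function.update_apply]
  split_ifs with hi hi' hi'
  · exact absurd (hi.trans hi'.symm) hii'
  · exact hp i'
  · rw [cross_swap, neg_ne_zero]
    exact hp i
  · exact hr hii'

/-- The quotient `G / H` is a linear fractional function: all but one zero of `H` cancel. -/
theorem exists_forall_mul_cross_eq {d : ℕ} {G H : k × k → k} (hG : G ∈ binaryForms k d)
    (hH : H ∈ binaryForms k d) {r : Fin d → k × k}
    (hr : Pairwise fun i j => cross (r i) (r j) ≠ 0) (hHr : ∀ i, H (r i) = 0) {p₀ : k × k}
    (hp₀ : ∀ i, cross p₀ (r i) ≠ 0) (hHp₀ : H p₀ ≠ 0) {j : Fin d} (hGr : ∀ i ≠ j, G (r i) = 0)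
    (hGp₀ : G p₀ = 0) : ∃ c, ∀ p, G p * cross p (r j) = c * (H p * cross p p₀) := by
  let r' := Function.update r j p₀
  have hr'j : r' j = p₀ := Function.update_self ..
  have hr' {i} (hi : i ≠ j) : r' i = r i := Function.update_of_ne hi ..
  have hzero (i) : G (r' i) = 0 := by
    obtain rfl | hi := eq_or_ne i j
    · rwa [hr'j]
    · rw [hr' hi, hGr i hi]
  have hbase (i) : cross (r j) (r' i) ≠ 0 := by
    obtain rfl | hi := eq_or_ne i j
    · rw [hr'j, cross_swap, neg_ne_zero]
      exact hp₀ i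
    · rw [hr' hi]
      exact hr hi.symm
  have hprod : ∏ i, cross (r j) (r' i) ≠ 0 := Finset.prod_ne_zero_iff.2 fun i _ => hbase i
  refine ⟨G (r j) * (∏ i, cross p₀ (r i)) / (H p₀ * ∏ i, cross (r j) (r' i)), fun p => ?_⟩
  have hGp := mul_prod_cross_eq hG (pairwise_cross_update hr j hp₀) hzero hbase p
  have hHp := mul_prod_cross_eq hH hr hHr hp₀ p
  have hsplit : (∏ i, cross p (r' i)) * cross p (r j) = (∏ i, cross p (r i)) * cross p p₀ := by
    rw [Fintype.prod_eq_mul_prod_compl j, Fintype.prod_eq_mul_prod_compl j, hr'j,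
      Finset.prod_congr rfl fun i hi => by rw [hr' (by simpa using hi)]]
    ring
  field_simp
  linear_combination H p₀ * cross p (r j) * hGp - G (r j) * cross p p₀ * hHp +
    G (r j) * H p₀ * hsplit

theorem exists_pairwise_cross_ne_zero [Finite k] {d : ℕ} (hd : d ≤ Nat.card k) :
    ∃ p : Fin (d + 1) → k × k, Pairwise fun i j => cross (p i) (p j) ≠ 0 := by
  have := Fintype.ofFinite k
  rw [Nat.card_eq_fintype_card, ← Fintype.card_fin d] at hd
  obtain ⟨f⟩ := Function.Embedding.nonempty_of_card_le hd
  refine ⟨Fin.cons (0, 1) fun i => (1, f i), fun i j hij => ?_⟩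
  cases i using Fin.cases <;> cases j using Fin.cases <;> simp_all [cross, sub_eq_zero, ne_comm]

end BinaryForms

section NormalRationalCurves

variable {k V : Type*} [Field k] [AddCommGroup V] [Module k V] {d : ℕ} {e : Fin (d + 1) → V}

/-- The vector with parameters `p = (s, t)` on the rational curve given by the vectors `e i`. -/
def nrcVec (e : Fin (d + 1) → V) (p : k × k) : V :=
  ∑ i, veronese d p i • e i

variable (k) in
/-- The rational curve given by the vectors `e i`, as a point set. -/
def nrc (e : Fin (d + 1) → V) : Set (ℙ k V) := {P | ∃ p : k × k, IsPt (nrcVec e p) P}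

theorem isNRC_iff {C : Set (ℙ k V)} : IsNRC k d C ↔
    2 ≤ d ∧ d ≤ Nat.card k ∧ ∃ e : Fin (d + 1) → V, LinearIndependent k e ∧ C = nrc k e := by
  simp only [IsNRC, nrc, nrcVec, veronese, Prod.exists]

theorem map_nrcVec {V' : Type*} [AddCommGroup V'] [Module k V'] (l : V →ₗ[k] V') (p : k × k) :
    l (nrcVec e p) = nrcVec (fun i => l (e i)) p := by
  simp only [nrcVec, map_sum, map_smul]

theorem comp_nrcVec_mem_binaryForms (e : Fin (d + 1) → V) (l : V →ₗ[k] k) :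
    (fun p => l (nrcVec e p)) ∈ binaryForms k d :=
  mem_binaryForms_iff.2 ⟨fun i => l (e i), fun p => by
    rw [map_nrcVec]
    simp only [nrcVec, smul_eq_mul, mul_comm]⟩

theorem nrcVec_smul (e : Fin (d + 1) → V) (c : k) (p : k × k) :
    nrcVec e (c • p) = c ^ d • nrcVec e p := by
  simp only [nrcVec, veronese_smul, Pi.smul_apply, smul_assoc, Finset.smul_sum]

theorem nrcVec_zero_one (e : Fin (d + 1) → V) : nrcVec e ((0, 1) : k × k) = e (Fin.last d) := by
  simp [nrcVec, veronese_zero_one, Pi.single_apply]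

theorem nrcVec_zero (hd : d ≠ 0) (e : Fin (d + 1) → V) : nrcVec e (0 : k × k) = 0 := by
  rw [← zero_smul k (0 : k × k), nrcVec_smul, zero_pow hd, zero_smul]

theorem IsPt.eq_of_cross_eq_zero (hd : d ≠ 0) {p p' : k × k} {P P' : ℙ k V}
    (h : IsPt (nrcVec e p) P) (h' : IsPt (nrcVec e p') P') (hp : cross p p' = 0) : P = P' := by
  have hp0 : p ≠ 0 := by
    rintro rfl
    exact h.ne_zero (nrcVec_zero hd e)
  obtain ⟨c, rfl⟩ := exists_smul_of_cross_eq_zero hp0 hp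
  rw [nrcVec_smul] at h'
  exact h.unique h'.of_smul

theorem mem_nrc_iff {P : ℙ k V} :
    P ∈ nrc k e ↔ IsPt (e (Fin.last d)) P ∨ ∃ t : k, IsPt (nrcVec e (1, t)) P := by
  constructor
  · rintro ⟨⟨s, t⟩, h⟩
    obtain rfl | hs := eq_or_ne s 0
    · left
      rw [show ((0, t) : k × k) = t • (0, 1) by simp, nrcVec_smul, nrcVec_zero_one] at h
      exact h.of_smul
    · right
      rw [show ((s, t) : k × k) = s • (1, t / s) by simp [mul_div_cancel₀ _ hs], nrcVec_smul] at h
      exact ⟨t / s, h.of_smul⟩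
  · rintro (h | ⟨t, h⟩)
    · exact ⟨(0, 1), by rwa [nrcVec_zero_one]⟩
    · exact ⟨(1, t), h⟩

theorem exists_veronese_eq_smul (he : LinearIndependent k e) {p p' : k × k} {P : ℙ k V}
    (h : IsPt (nrcVec e p) P) (h' : IsPt (nrcVec e p') P) :
    ∃ c : k, veronese d p' = c • veronese d p := by
  obtain ⟨c, -, hc⟩ := h.iff_exists_smul.1 h'
  refine ⟨c, he.fintypeLinearCombination_injective ?_⟩
  rw [map_smul]
  exact hc

theorem ncard_nrc [Finite k] (hd : d ≠ 0) (he : LinearIndependent k e) :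
    (nrc k e).ncard = Nat.card k + 1 := by
  have h1 (t : k) : nrcVec e (1, t) ≠ 0 := fun h => by
    simpa [veronese] using Fintype.linearIndependent_iff.1 he _ h 0
  have hinj : Function.Injective fun t : k => Projectivization.mk k _ (h1 t) := by
    intro t t' (h : Projectivization.mk k _ (h1 t) = Projectivization.mk k _ (h1 t'))
    obtain ⟨c, hc⟩ := exists_veronese_eq_smul he (isPt_mk (h1 t)) (h ▸ isPt_mk (h1 t'))
    have hc0 : 1 = c := by simpa [veronese] using congrFun hc 0
    have hc1 := congrFun hc ⟨1, by omega⟩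
    simpa [veronese, ← hc0, eq_comm] using hc1
  have hnotMem : Projectivization.mk k _ (he.ne_zero (Fin.last d)) ∉
      Set.range fun t : k => Projectivization.mk k _ (h1 t) := by
    rintro ⟨t, h : Projectivization.mk k _ (h1 t) = _⟩
    have hinf : IsPt (nrcVec e ((0, 1) : k × k)) (Projectivization.mk k _ (h1 t)) := by
      rw [h, nrcVec_zero_one]
      exact isPt_mk _
    obtain ⟨c, hc⟩ := exists_veronese_eq_smul he hinf (isPt_mk (h1 t))
    simpa [veronese, hd] using congrFun hc 0
  have hnrc : nrc k e = insert (Projectivization.mk k _ (he.ne_zero (Fin.last d)))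
      (Set.range fun t : k => Projectivization.mk k _ (h1 t)) := by
    ext P
    rw [mem_nrc_iff, Set.mem_insert_iff, Set.mem_range]
    refine or_congr ⟨IsPt.eq_mk, fun h => h ▸ isPt_mk _⟩ (exists_congr fun t => ?_)
    exact ⟨fun h => h.eq_mk.symm, fun h => h ▸ isPt_mk _⟩
  rw [hnrc, Set.ncard_insert_of_notMem hnotMem (Set.finite_range _), ← Set.image_univ,
    Set.ncard_image_of_injective _ hinj, Set.ncard_univ]

theorem nrc_subset_pts_iff [Finite k] (hd : d ≤ Nat.card k) {W : Submodule k V} :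
    nrc k e ⊆ pts k W ↔ Set.range e ⊆ W := by
  constructor
  · rintro h _ ⟨i, rfl⟩
    by_contra hi
    obtain ⟨l, hl, hlW⟩ := Submodule.exists_le_ker_of_notMem hi
    obtain ⟨p, hp⟩ := exists_pairwise_cross_ne_zero hd
    have hzero (j) : l (nrcVec e (p j)) = 0 := by
      by_cases h0 : nrcVec e (p j) = 0
      · rw [h0, map_zero]
      · exact hlW (((isPt_mk h0).mem_pts_iff W).1 (h ⟨p j, isPt_mk h0⟩))
    refine hl (congrFun (coeff_eq_zero_of_forall_sum_eq_zero (g := l ∘ e) hp fun j => ?_) i)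
    rw [← hzero j, map_nrcVec]
    exact Finset.sum_congr rfl fun i _ => mul_comm _ _
  · rintro h P ⟨p, hP⟩
    exact (hP.mem_pts_iff W).2
      (Submodule.sum_mem _ fun i _ => Submodule.smul_mem _ _ (h (Set.mem_range_self i)))

theorem IsNRC.degree_unique [Finite k] {d d' : ℕ} {C : Set (ℙ k V)} (h : IsNRC k d C)
    (h' : IsNRC k d' C) : d = d' := by
  suffices ∀ {d d' : ℕ}, IsNRC k d C → IsNRC k d' C → d ≤ d' from (this h h').antisymm (this h' h)
  intro d d' h h'
  obtain ⟨-, hd, e, he, rfl⟩ := isNRC_iff.1 h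
  obtain ⟨-, hd', e', he', heq⟩ := isNRC_iff.1 h'
  have hsub : Set.range e ⊆ Submodule.span k (Set.range e') := by
    rw [← nrc_subset_pts_iff hd, heq, nrc_subset_pts_iff hd']
    exact Submodule.subset_span
  have : Module.Finite k (Submodule.span k (Set.range e')) :=
    FiniteDimensional.span_of_finite k (Set.finite_range e')
  have := Submodule.finrank_mono (Submodule.span_le.2 hsub)
  rw [finrank_span_eq_card he, finrank_span_eq_card he', Fintype.card_fin, Fintype.card_fin] at this
  omega

end NormalRationalCurves

section AffinePoints

variable {k K : Type*} [Field k] [Field K] [Algebra k K]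

variable (k) in
/-- The coordinate vector `(x, 1)` of the point with affine coordinates `x`, both in
`PG(2, q^n)` (where `k = K`) and in `PG(2n, q)` (where `k = F`). -/
def affVec (x : K × K) : K × K × k := (x.1, x.2, 1)

variable (k) in
/-- The vector `(x, 0)` at infinity. -/
def infVec : K × K →ₗ[k] K × K × k where
  toFun x := (x.1, x.2, 0)
  map_add' x y := by simp
  map_smul' c x := by simp

theorem infVec_injective : Function.Injective (infVec k : K × K → K × K × k) := by
  intro x y h
  simp only [infVec, LinearMap.coe_mk, AddHom.coe_mk, Prod.mk.injEq] at h
  exact Prod.ext h.1 h.2.1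

theorem exists_eq_infVec {u : K × K × k} (hu : u.2.2 = 0) : ∃ x, u = infVec k x :=
  ⟨(u.1, u.2.1), Prod.ext rfl (Prod.ext rfl hu)⟩

theorem exists_eq_smul_affVec {u : K × K × k} (hu : u.2.2 ≠ 0) :
    ∃ x, u = u.2.2 • affVec k x := by
  refine ⟨u.2.2⁻¹ • (u.1, u.2.1), ?_⟩
  ext <;> simp [affVec, hu]

omit [Algebra k K] in
theorem affVec_ne_zero (x : K × K) : affVec k x ≠ 0 := fun h =>
  one_ne_zero (congrArg (fun u => u.2.2) h)

variable (k) in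
/-- The point with affine coordinates `x`. -/
def affPt (x : K × K) : ℙ k (K × K × k) := Projectivization.mk k (affVec k x) (affVec_ne_zero x)

theorem isPt_affPt (x : K × K) : IsPt (affVec k x) (affPt k x) := isPt_mk _

theorem affPt_injective : Function.Injective (affPt k : K × K → ℙ k (K × K × k)) := by
  intro x y h
  obtain ⟨c, -, hc⟩ := (isPt_affPt x).iff_exists_smul.1 (h ▸ isPt_affPt y)
  simp only [affVec, Prod.smul_mk, Prod.mk.injEq, smul_eq_mul, mul_one] at hc
  obtain ⟨h1, h2, rfl⟩ := hc
  rw [one_smul] at h1 h2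
  exact Prod.ext h1.symm h2.symm

theorem IsPt.exists_isPt_zero_iff {u : K × K × k} {P : ℙ k (K × K × k)} (h : IsPt u P) :
    (∃ a b : K, IsPt ((a, b, 0) : K × K × k) P) ↔ u.2.2 = 0 := by
  constructor
  · rintro ⟨a, b, hab⟩
    obtain ⟨c, -, rfl⟩ := hab.iff_exists_smul.1 h
    simp
  · intro h0
    refine ⟨u.1, u.2.1, ?_⟩
    rwa [← h0]

theorem IsPt.mem_lInf_iff {u : K × K × K} {P : Plane K} (h : IsPt u P) :
    P ∈ lInf K ↔ u.2.2 = 0 := h.exists_isPt_zero_iff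

theorem IsPt.mem_hInf_iff {u : K × K × k} {P : Sig k K} (h : IsPt u P) :
    P ∈ hInf k K ↔ u.2.2 = 0 := h.exists_isPt_zero_iff

theorem affPt_notMem_lInf (x : K × K) : affPt K x ∉ lInf K := by
  rw [(isPt_affPt x).mem_lInf_iff]
  exact one_ne_zero

theorem exists_affPt_eq_of_notMem_hInf {P : Sig k K} (hP : P ∉ hInf k K) :
    ∃ x, affPt k x = P := by
  obtain ⟨u, hu⟩ := exists_isPt P
  rw [hu.mem_hInf_iff] at hP
  obtain ⟨x, hx⟩ := exists_eq_smul_affVec hP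
  exact ⟨x, (isPt_affPt x).unique (IsPt.of_smul (hx ▸ hu))⟩

theorem abb_affPt (x : K × K) : abb k K (affPt K x) = {affPt k x} := by
  ext R
  constructor
  · rintro ⟨a, b, ⟨h, h'⟩ | ⟨h, -⟩⟩
    · obtain rfl : (a, b) = x := affPt_injective ((isPt_affPt (a, b)).unique h)
      exact h'.unique (isPt_affPt (a, b))
    · exact absurd ⟨a, b, h⟩ (affPt_notMem_lInf x)
  · rintro rfl
    exact ⟨x.1, x.2, Or.inl ⟨isPt_affPt x, isPt_affPt x⟩⟩

theorem abbImage_image_affPt (S : Set (K × K)) :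
    abbImage k K (affPt K '' S) = affPt k '' S := by
  rw [abbImage, Set.biUnion_image, Set.image_eq_iUnion]
  exact Set.iUnion₂_congr fun x _ => abb_affPt x

end AffinePoints

section Sublines

variable {K : Type*} [Field K]

/-- The subline over `L` defined by the vectors `u` and `v`. -/
def subline (L : Subfield K) (u v : K × K × K) : Set (Plane K) :=
  {P | ∃ s ∈ L, ∃ t ∈ L, IsPt (s • u + t • v) P}

theorem isSubline_iff {Q : ℕ} {m : Set (Plane K)} : IsSubline K Q m ↔ ∃ L : Subfield K,
    Nat.card L = Q ∧ ∃ u v, LinearIndependent K ![u, v] ∧ m = subline L u v := Iff.rfl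

theorem subline_mono {L L' : Subfield K} (h : L ≤ L') (u v : K × K × K) :
    subline L u v ⊆ subline L' u v := by
  rintro P ⟨s, hs, t, ht, hP⟩
  exact ⟨s, h hs, t, h ht, hP⟩

theorem subline_smul (L : Subfield K) (u v : K × K × K) {c : K} (hc : c ≠ 0) :
    subline L (c • u) (c • v) = subline L u v := by
  have h (s t : K) : s • c • u + t • c • v = c • (s • u + t • v) := by module
  simp only [subline, h, isPt_smul_iff hc]

theorem mem_subline_iff {L : Subfield K} {u v : K × K × K} {P : Plane K} :
    P ∈ subline L u v ↔ ∃ x ∈ Submodule.span L {u, v}, IsPt x P := by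
  simp only [subline, Set.mem_ofPred_eq, Submodule.mem_span_pair]
  constructor
  · rintro ⟨s, hs, t, ht, h⟩
    exact ⟨_, ⟨⟨s, hs⟩, ⟨t, ht⟩, rfl⟩, h⟩
  · rintro ⟨_, ⟨s, t, rfl⟩, h⟩
    exact ⟨s, s.2, t, t.2, h⟩

theorem span_pair_eq_of_mem {L : Subfield K} {u v u' v' : K × K × K}
    (huv : LinearIndependent K ![u, v]) (hu : u ∈ Submodule.span L {u', v'})
    (hv : v ∈ Submodule.span L {u', v'}) : Submodule.span L {u, v} = Submodule.span L {u', v'} := by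
  have hL : LinearIndependent L ![u, v] := huv.restrict_scalars <| by
    simpa only [Algebra.smul_def, mul_one] using (algebraMap L K).injective
  have : Module.Finite L (Submodule.span L {u', v'}) :=
    FiniteDimensional.span_of_finite L (Set.toFinite _)
  refine Submodule.eq_of_le_of_finrank_le (Submodule.span_le.2 (Set.pair_subset hu hv)) ?_
  have h := finrank_span_eq_card hL
  have h' := finrank_range_le_card (R := L) ![u', v']
  rw [Set.finrank, Matrix.range_cons_cons_empty] at h'
  rw [Matrix.range_cons_cons_empty] at h
  rwa [h]

/-- A coordinate frame `u, v, u + v` of a subline determines it once its field is known. -/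
theorem subline_eq_of_mem {L : Subfield K} {u v u' v' : K × K × K}
    (huv : LinearIndependent K ![u, v]) {a b c : K} (ha : a ≠ 0) (hb : b ≠ 0) (hc : c ≠ 0)
    (hu : a • u ∈ Submodule.span L {u', v'}) (hv : b • v ∈ Submodule.span L {u', v'})
    (h : c • (u + v) ∈ Submodule.span L {u', v'}) : subline L u' v' = subline L u v := by
  have hspan := span_pair_eq_of_mem
    ((LinearIndependent.pair_smul_smul_iff ha.isUnit hb.isUnit).2 huv) hu hv
  have hcuv := h
  rw [← hspan, Submodule.mem_span_pair] at hcuv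
  obtain ⟨s, t, hst⟩ := hcuv
  have hst' : ((s : K) * a) • u + ((t : K) * b) • v = c • u + c • v := by
    rw [mul_smul, mul_smul, ← smul_add]
    exact hst
  obtain ⟨hs, ht⟩ := huv.eq_of_pair hst'
  have hcu : c • u = s • a • u := by
    rw [← hs, mul_smul]
    rfl
  have hcv : c • v = t • b • v := by
    rw [← ht, mul_smul]
    rfl
  have hspan' : Submodule.span L {c • u, c • v} = Submodule.span L {u', v'} :=
    span_pair_eq_of_mem ((LinearIndependent.pair_smul_iff hc).2 huv)
      (hcu ▸ Submodule.smul_mem _ s hu) (hcv ▸ Submodule.smul_mem _ t hv)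
  rw [← subline_smul L u v hc]
  ext P
  rw [mem_subline_iff, mem_subline_iff, hspan']

theorem subline_eq_of_subset {L L' : Subfield K} {u v u' v' : K × K × K}
    (huv : LinearIndependent K ![u, v]) (h : subline L u v ⊆ subline L' u' v') :
    subline L' u' v' = subline L' u v := by
  have hmem {s t : K} (hs : s ∈ L) (ht : t ∈ L) (h0 : s ≠ 0 ∨ t ≠ 0) :
      ∃ c : K, c ≠ 0 ∧ c • (s • u + t • v) ∈ Submodule.span L' {u', v'} := by
    have hne : s • u + t • v ≠ 0 := fun e => by
      have := LinearIndependent.pair_iff.1 huv s t e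
      tauto
    obtain ⟨x, hx, hxP⟩ := mem_subline_iff.1 (h ⟨s, hs, t, ht, isPt_mk hne⟩)
    obtain ⟨c, hc, rfl⟩ := (isPt_mk hne).iff_exists_smul.1 hxP
    exact ⟨c, hc, hx⟩
  obtain ⟨a, ha, hu⟩ := hmem L.one_mem L.zero_mem (Or.inl one_ne_zero)
  obtain ⟨b, hb, hv⟩ := hmem L.zero_mem L.one_mem (Or.inr one_ne_zero)
  obtain ⟨c, hc, huv'⟩ := hmem L.one_mem L.one_mem (Or.inr one_ne_zero)
  simp only [one_smul, zero_smul, zero_add, add_zero] at hu hv huv'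
  exact subline_eq_of_mem huv ha hb hc hu hv huv'

theorem le_of_subline_subset {L L' : Subfield K} {u v : K × K × K}
    (huv : LinearIndependent K ![u, v]) (h : subline L u v ⊆ subline L' u v) : L ≤ L' := by
  intro t ht
  have hne : (1 : K) • u + t • v ≠ 0 := fun e =>
    one_ne_zero (LinearIndependent.pair_iff.1 huv 1 t e).1
  obtain ⟨s', hs', t', ht', h'⟩ := h ⟨1, L.one_mem, t, ht, isPt_mk hne⟩
  obtain ⟨c, hc, e⟩ := (isPt_mk hne).iff_exists_smul.1 h'
  rw [smul_add, smul_smul, smul_smul, mul_one] at e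
  obtain ⟨rfl, rfl⟩ := huv.eq_of_pair e
  rw [← mul_div_cancel_left₀ t hc]
  exact L'.div_mem ht' hs'

/-- The vector which, together with `affVec K v`, defines the sublines whose line has the point at
infinity `(w, 0)`, this point having the parameter `θ`. -/
def poleVec (v w : K × K) (θ : K) : K × K × K := infVec K w - θ • affVec K v

theorem smul_poleVec_add_smul_affVec (v w : K × K) (θ s t : K) :
    s • poleVec v w θ + t • affVec K v = s • infVec K w + (t - s * θ) • affVec K v := by
  rw [poleVec]
  module

theorem linearIndependent_poleVec_affVec (v : K × K) {w : K × K} (hw : w ≠ 0) (θ : K) :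
    LinearIndependent K ![poleVec v w θ, affVec K v] := by
  rw [LinearIndependent.pair_iff]
  intro s t h
  rw [smul_poleVec_add_smul_affVec] at h
  have ht : t - s * θ = 0 := by simpa [infVec, affVec] using congrArg (fun x => x.2.2) h
  rw [ht, zero_smul, add_zero, ← map_smul, ← map_zero (infVec K)] at h
  obtain rfl := (smul_eq_zero.1 (infVec_injective h)).resolve_right hw
  simpa using ht

theorem mem_of_mem_subline_of_mem_lInf {L : Subfield K} {v w : K × K} {θ : K} {P : Plane K}
    (hP : P ∈ subline L (poleVec v w θ) (affVec K v)) (hP' : P ∈ lInf K) :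
    θ ∈ L ∧ IsPt (infVec K w) P := by
  obtain ⟨s, hs, t, ht, h⟩ := hP
  rw [smul_poleVec_add_smul_affVec] at h
  have h0 : t - s * θ = 0 := by simpa [infVec, affVec] using h.mem_lInf_iff.1 hP'
  rw [h0, zero_smul, add_zero] at h
  have hs0 : s ≠ 0 := left_ne_zero_of_smul h.ne_zero
  rw [← mul_div_cancel_left₀ θ hs0, ← sub_eq_zero.1 h0]
  exact ⟨L.div_mem ht hs, h.of_smul⟩

theorem external_subline {L : Subfield K} (v w : K × K) {θ : K} (hθ : θ ∉ L) :
    External (subline L (poleVec v w θ) (affVec K v)) :=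
  Set.eq_empty_iff_forall_notMem.2 fun _ hP => hθ (mem_of_mem_subline_of_mem_lInf hP.1 hP.2).1

theorem tangent_subline {L : Subfield K} (v : K × K) {w : K × K} (hw : w ≠ 0) {θ : K}
    (hθ : θ ∈ L) : Tangent (subline L (poleVec v w θ) (affVec K v)) := by
  have hw0 : infVec K w ≠ 0 := (map_ne_zero_iff _ infVec_injective).2 hw
  rw [Tangent, Set.ncard_eq_one]
  refine ⟨Projectivization.mk K _ hw0, Set.eq_singleton_iff_unique_mem.2 ⟨⟨?_, ?_⟩, ?_⟩⟩
  · refine ⟨1, L.one_mem, θ, hθ, ?_⟩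
    rw [smul_poleVec_add_smul_affVec]
    simpa using isPt_mk hw0
  · exact (isPt_mk hw0).mem_lInf_iff.2 rfl
  · rintro P ⟨hP, hP'⟩
    exact (mem_of_mem_subline_of_mem_lInf hP hP').2.unique (isPt_mk hw0)

theorem exists_subline_eq_of_external {L : Subfield K} {u v : K × K × K}
    (huv : LinearIndependent K ![u, v]) (hext : External (subline L u v)) :
    ∃ (v' w : K × K) (θ : K), w ≠ 0 ∧ θ ∉ L ∧
      subline L u v = subline L (poleVec v' w θ) (affVec K v') := by
  have hfree {s t : K} (hs : s ∈ L) (ht : t ∈ L) (h : (s • u + t • v).2.2 = 0) :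
      s = 0 ∧ t = 0 := by
    refine LinearIndependent.pair_iff.1 huv s t ?_
    by_contra h0
    exact Set.eq_empty_iff_forall_notMem.1 hext _
      ⟨⟨s, hs, t, ht, isPt_mk h0⟩, (isPt_mk h0).mem_lInf_iff.2 h⟩
  have hc : v.2.2 ≠ 0 := fun h =>
    one_ne_zero (hfree L.zero_mem L.one_mem (by simpa using h)).2
  obtain ⟨v', hv'⟩ := exists_eq_smul_affVec hc
  set c := v.2.2
  let θ := -(u.2.2 / c)
  have h0 : (u + θ • v).2.2 = 0 := by simp [θ, c, hc]
  obtain ⟨w, hw⟩ := exists_eq_infVec (u := c⁻¹ • (u + θ • v))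
    (by rw [Prod.smul_snd, Prod.smul_snd, h0, smul_zero])
  have hu : u = c • poleVec v' w θ := by
    rw [poleVec, ← hw, smul_sub, smul_inv_smul₀ hc, smul_comm, ← hv', add_sub_cancel_right]
  refine ⟨v', w, θ, ?_, fun hθ => ?_, ?_⟩
  · rintro rfl
    rw [map_zero, smul_eq_zero_iff_right (inv_ne_zero hc)] at hw
    exact one_ne_zero (LinearIndependent.pair_iff.1 huv 1 θ (by rwa [one_smul])).1
  · exact one_ne_zero (hfree L.one_mem hθ (by rwa [one_smul])).1
  · conv_lhs => rw [hu, hv']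
    exact subline_smul L _ _ hc

theorem isSmallestTangentSubline_subline [Finite K] {L L' : Subfield K} (v : K × K) {w : K × K}
    {θ : K} (hw : w ≠ 0) (hLL' : L ≤ L') (hθ : θ ∈ L')
    (hmin : ∀ M : Subfield K, L ≤ M → θ ∈ M → L' ≤ M) :
    IsSmallestTangentSubline (subline L (poleVec v w θ) (affVec K v))
      (subline L' (poleVec v w θ) (affVec K v)) := by
  have hind := linearIndependent_poleVec_affVec v hw θ
  refine ⟨⟨⟨_, isSubline_iff.2 ⟨L', rfl, _, _, hind, rfl⟩⟩, subline_mono hLL' _ _,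
    tangent_subline v hw hθ⟩, ?_⟩
  rintro m ⟨⟨Q, hm⟩, hsub, htan⟩ hne
  obtain ⟨M, -, u', v', -, rfl⟩ := isSubline_iff.1 hm
  have heq := subline_eq_of_subset hind hsub
  rw [heq] at hsub htan hne ⊢
  obtain ⟨P, hP, hP'⟩ := Set.nonempty_of_ncard_ne_zero (htan.trans_ne one_ne_zero)
  have hθM := (mem_of_mem_subline_of_mem_lInf hP hP').1
  have : Finite (Plane K) := Quotient.finite _
  have hle := hmin M (le_of_subline_subset hind hsub) hθM
  exact Set.ncard_lt_ncard ((subline_mono hle _ _).ssubset_of_ne hne.symm) (Set.toFinite _)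

end Sublines

section AffineSublines

theorem ncard_setOf_pow_eq_self_le (K : Type*) [Field K] {Q : ℕ} (hQ : 1 < Q) :
    {x : K | x ^ Q = x}.ncard ≤ Q := by
  have h : {x : K | x ^ Q = x} = (Polynomial.X ^ Q - Polynomial.X : Polynomial K).rootSet K := by
    ext x
    simp [Polynomial.mem_rootSet, FiniteField.X_pow_card_sub_X_ne_zero K hQ, sub_eq_zero]
  rw [h]
  exact (Polynomial.ncard_rootSet_le _ _).trans_eq (FiniteField.X_pow_card_sub_X_natDegree_eq K hQ)

theorem mem_subfield_iff_pow_eq_self {K : Type*} [Field K] [Finite K] (L : Subfield K) {x : K} :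
    x ∈ L ↔ x ^ Nat.card L = x := by
  have := Fintype.ofFinite L
  have hcard := ncard_setOf_pow_eq_self_le K (Finite.one_lt_card (α := L))
  have hsub : (L : Set K) ⊆ {x | x ^ Nat.card L = x} := fun y hy => by
    rw [Nat.card_eq_fintype_card]
    exact congrArg Subtype.val (FiniteField.pow_card (⟨y, hy⟩ : L))
  exact Set.ext_iff.1 (Set.eq_of_subset_of_ncard_le hsub hcard) x

variable (F : Type*) {K : Type*} [Field F] [Field K] [Algebra F K]

theorem card_fieldRange : Nat.card (algebraMap F K).fieldRange = Nat.card F :=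
  Nat.card_congr (RingHom.rangeRestrictFieldEquiv (algebraMap F K)).symm.toEquiv

theorem fieldRange_eq_of_card [Finite K] {L : Subfield K} (hL : Nat.card L = Nat.card F) :
    L = (algebraMap F K).fieldRange := by
  ext x
  rw [mem_subfield_iff_pow_eq_self, mem_subfield_iff_pow_eq_self, hL, card_fieldRange]

/-- The affine coordinates `v` and `v + (t - θ)⁻¹ w`, for `t ∈ F`, of the points of an external
subline over `F`, where `θ ∉ F` is the parameter of the point at infinity `(w, 0)` of its line. -/
def affineSubline (v w : K × K) (θ : K) : Set (K × K) :=
  insert v (Set.range fun t : F => v + (algebraMap F K t - θ)⁻¹ • w)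

variable {F}

theorem subline_eq_image_affPt {θ : K} (hθ : θ ∉ (algebraMap F K).fieldRange) (v w : K × K) :
    subline (algebraMap F K).fieldRange (poleVec v w θ) (affVec K v) =
      affPt K '' affineSubline F v w θ := by
  have hne (t : F) : algebraMap F K t - θ ≠ 0 := fun h => hθ ⟨t, sub_eq_zero.1 h⟩
  have hvec (s : K) (t : F) : s • poleVec v w θ + (s * algebraMap F K t) • affVec K v =
      (s * (algebraMap F K t - θ)) • affVec K (v + (algebraMap F K t - θ)⁻¹ • w) := by
    have h : (algebraMap F K t - θ) • affVec K (v + (algebraMap F K t - θ)⁻¹ • w) =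
        (algebraMap F K t - θ) • affVec K v + infVec K w := by
      ext <;> simp [affVec, infVec, mul_add, hne t]
    rw [smul_poleVec_add_smul_affVec, mul_smul, h]
    module
  ext P
  constructor
  · rintro ⟨_, ⟨s, rfl⟩, _, ⟨t, rfl⟩, hP⟩
    obtain rfl | hs := eq_or_ne s 0
    · rw [map_zero, zero_smul, zero_add] at hP
      exact ⟨v, Set.mem_insert _ _, (isPt_affPt v).unique hP.of_smul⟩
    · rw [← mul_div_cancel₀ t hs, map_mul, hvec] at hP
      exact ⟨_, Set.mem_insert_of_mem _ ⟨t / s, rfl⟩, (isPt_affPt _).unique hP.of_smul⟩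
  · rintro ⟨x, rfl | ⟨t, rfl⟩, rfl⟩
    · refine ⟨0, Subfield.zero_mem _, 1, Subfield.one_mem _, ?_⟩
      simpa using isPt_affPt x
    · refine ⟨1, Subfield.one_mem _, algebraMap F K t, ⟨t, rfl⟩, ?_⟩
      rw [← one_mul (algebraMap F K t), hvec, isPt_smul_iff (by simpa using hne t)]
      exact isPt_affPt _

theorem exists_eq_subline_of_external [Finite K] {m : Set (Plane K)}
    (hm : IsSubline K (Nat.card F) m) (hext : External m) :
    ∃ (v w : K × K) (θ : K), w ≠ 0 ∧ θ ∉ (algebraMap F K).fieldRange ∧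
      m = subline (algebraMap F K).fieldRange (poleVec v w θ) (affVec K v) := by
  obtain ⟨L, hL, u, v, huv, rfl⟩ := isSubline_iff.1 hm
  obtain rfl := fieldRange_eq_of_card F hL
  exact exists_subline_eq_of_external huv hext

theorem exists_external_iff [Finite K] {C : Set (Sig F K)} :
    (∃ m : Set (Plane K), IsSubline K (Nat.card F) m ∧ External m ∧ C = abbImage F K m) ↔
      ∃ (v w : K × K) (θ : K), w ≠ 0 ∧ θ ∉ (algebraMap F K).fieldRange ∧
        C = affPt F '' affineSubline F v w θ := by
  constructor
  · rintro ⟨m, hm, hext, rfl⟩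
    obtain ⟨v, w, θ, hw, hθ, rfl⟩ := exists_eq_subline_of_external hm hext
    exact ⟨v, w, θ, hw, hθ, by rw [subline_eq_image_affPt hθ, abbImage_image_affPt]⟩
  · rintro ⟨v, w, θ, hw, hθ, rfl⟩
    exact ⟨_, isSubline_iff.2 ⟨_, card_fieldRange F, _, _, linearIndependent_poleVec_affVec v hw θ,
      rfl⟩, external_subline v w hθ, by rw [subline_eq_image_affPt hθ, abbImage_image_affPt]⟩

end AffineSublines

section Frobenius

variable {F K : Type*} [Field F] [Fintype F] [Field K] [Algebra F K]

theorem frobeniusAlgHom_pow_apply (i : ℕ) (x : K) :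
    (FiniteField.frobeniusAlgHom F K ^ i) x = x ^ Fintype.card F ^ i := by
  rw [AlgHom.coe_pow, FiniteField.coe_frobeniusAlgHom, pow_iterate]

theorem pow_card_pow_eq_of_modEq [Finite K] {i j : ℕ} (h : i ≡ j [MOD Module.finrank F K])
    (x : K) : x ^ Fintype.card F ^ i = x ^ Fintype.card F ^ j := by
  have h' : i ≡ j [MOD orderOf (FiniteField.frobeniusAlgHom F K)] := by
    rwa [FiniteField.orderOf_frobeniusAlgHom]
  rw [← frobeniusAlgHom_pow_apply, ← pow_mod_orderOf, h', pow_mod_orderOf,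
    frobeniusAlgHom_pow_apply]

end Frobenius

section Collineation

variable {F K : Type*} [Field F] [Fintype F] [Field K] [Algebra F K] {n : ℕ} [NeZero n]

theorem val_sub_one_add_one_modEq (i : Fin n) : ((i - 1 : Fin n) : ℕ) + 1 ≡ i [MOD n] := by
  have h : ((i - 1 + 1 : Fin n) : ℕ) = i := by rw [sub_add_cancel]
  rw [Fin.val_add, Fin.val_one', Nat.add_mod_mod] at h
  rw [Nat.ModEq, h, Nat.mod_eq_of_lt i.2]

theorem sigmaVec_iotaVec [Finite K] (hn : Module.finrank F K = n) (x : K × K × F) :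
    sigmaVec F K n (iotaVec F K n x) = iotaVec F K n x := by
  have h (y : K) (i : Fin n) : (y ^ Fintype.card F ^ ((i - 1 : Fin n) : ℕ)) ^ Fintype.card F =
      y ^ Fintype.card F ^ (i : ℕ) := by
    rw [← pow_mul, ← pow_succ]
    exact pow_card_pow_eq_of_modEq (hn ▸ val_sub_one_add_one_modEq i) y
  have hlast := algebraMap_pow_q F (K := K) 1 x.2.2
  rw [pow_one] at hlast
  exact Prod.ext (funext (h _)) (Prod.ext (funext (h _)) hlast)

theorem IsPt.iota {x : K × K × F} {P : Sig F K} (h : IsPt x P) :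
    IsPt (iotaVec F K n x) (iota F K n P) := h.map _ (iotaVec_injective F K n)

theorem IsPt.sigma_iterate {x : VStar K n} {P : SigStar K n} (h : IsPt x P) (j : ℕ) :
    IsPt ((sigmaVec F K n)^[j] x) ((sigma F K n)^[j] P) := by
  induction j with
  | zero => exact h
  | succ j ih =>
    rw [Function.iterate_succ_apply', Function.iterate_succ_apply']
    exact ih.map _ (sigmaVec_injective F K n)

theorem sigma_iota [Finite K] (hn : Module.finrank F K = n) (P : Sig F K) :
    sigma F K n (iota F K n P) = iota F K n P := by
  obtain ⟨x, hx⟩ := exists_isPt P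
  have h := hx.iota.sigma_iterate (F := F) (n := n) 1
  rw [Function.iterate_one, Function.iterate_one, sigmaVec_iotaVec hn] at h
  exact h.unique hx.iota

variable (K n) in
/-- The vectors at infinity whose coordinates are zero outside the residue class of `r` modulo `k`;
for `k ∣ n` this is the span of `Π^{σ^r}`. -/
def classSpace (k r : ℕ) : Submodule K (VStar K n) where
  carrier := {x | x.2.2 = 0 ∧ ∀ i : Fin n, ¬ (i : ℕ) ≡ r [MOD k] → x.1 i = 0 ∧ x.2.1 i = 0}
  zero_mem' := ⟨rfl, fun _ _ => ⟨rfl, rfl⟩⟩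
  add_mem' := by
    rintro x y ⟨hx, hx'⟩ ⟨hy, hy'⟩
    refine ⟨by simp [hx, hy], fun i hi => ?_⟩
    simp [hx' i hi, hy' i hi]
  smul_mem' := by
    rintro c x ⟨hx, hx'⟩
    refine ⟨by simp [hx], fun i hi => ?_⟩
    simp [hx' i hi]

omit [NeZero n] in
theorem modEq_of_mem_classSpace {k r r' : ℕ} {x : VStar K n} (hx0 : x ≠ 0)
    (hx : x ∈ classSpace K n k r) (hx' : x ∈ classSpace K n k r') : r ≡ r' [MOD k] := by
  by_contra h
  have hzero (i : Fin n) : x.1 i = 0 ∧ x.2.1 i = 0 := by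
    by_cases hi : (i : ℕ) ≡ r [MOD k]
    · exact hx'.2 i fun hi' => h (hi.symm.trans hi')
    · exact hx.2 i hi
  exact hx0 (Prod.ext (funext fun i => (hzero i).1) (Prod.ext (funext fun i => (hzero i).2) hx.1))

theorem sigmaVec_mem_classSpace {k r : ℕ} (hkn : k ∣ n) {x : VStar K n}
    (hx : x ∈ classSpace K n k r) : sigmaVec F K n x ∈ classSpace K n k (r + 1) := by
  have hq : Fintype.card F ≠ 0 := Fintype.card_ne_zero
  refine ⟨?_, fun i hi => ?_⟩
  · change x.2.2 ^ Fintype.card F = 0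
    rw [hx.1, zero_pow hq]
  · obtain ⟨h1, h2⟩ := hx.2 (i - 1) fun h =>
      hi (((val_sub_one_add_one_modEq i).of_dvd hkn).symm.trans (h.add_right 1))
    change x.1 (i - 1) ^ Fintype.card F = 0 ∧ x.2.1 (i - 1) ^ Fintype.card F = 0
    rw [h1, h2, zero_pow hq]
    exact ⟨rfl, rfl⟩

theorem sigmaVec_iterate_mem_classSpace {k r : ℕ} (hkn : k ∣ n) {x : VStar K n}
    (hx : x ∈ classSpace K n k r) (j : ℕ) :
    (sigmaVec F K n)^[j] x ∈ classSpace K n k (r + j) := by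
  induction j with
  | zero => exact hx
  | succ j ih =>
    rw [Function.iterate_succ_apply']
    exact sigmaVec_mem_classSpace hkn ih

theorem nu_le_classSpace (k : ℕ) : nu K n ≤ classSpace K n k 0 := by
  have h0 (i : Fin n) (h : ¬ (i : ℕ) ≡ 0 [MOD k]) : i ≠ 0 := by
    rintro rfl
    exact h rfl
  rw [nu, Submodule.span_le]
  rintro _ (rfl | rfl)
  · exact ⟨rfl, fun i h => ⟨Pi.single_eq_of_ne (h0 i h) _, rfl⟩⟩
  · exact ⟨rfl, fun i h => ⟨rfl, Pi.single_eq_of_ne (h0 i h) _⟩⟩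

theorem span_sigmaVec_nu_le_classSpace {k : ℕ} (hkn : k ∣ n) :
    Submodule.span K {y | ∃ r < n / k, ∃ x ∈ nu K n, y = (sigmaVec F K n)^[k * r] x} ≤
      classSpace K n k 0 := by
  rw [Submodule.span_le]
  rintro _ ⟨r, -, x, hx, rfl⟩
  obtain ⟨h, h'⟩ :=
    sigmaVec_iterate_mem_classSpace (F := F) hkn (nu_le_classSpace k hx) (k * r)
  refine ⟨h, fun i hi => h' i ?_⟩
  rwa [Nat.ModEq, zero_add, Nat.mul_mod_right]

theorem exists_mem_classSpace_of_mem_indicatorPoints {k : ℕ} (hkn : k ∣ n) {P : SigStar K n}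
    (hP : P ∈ indicatorPoints F K n k) : ∃ r, ∃ x ∈ classSpace K n k r, IsPt x P := by
  simp only [indicatorPoints, Set.mem_iUnion] at hP
  obtain ⟨j, -, R, ⟨hR, -⟩, rfl⟩ := hP
  obtain ⟨x, hx⟩ := exists_isPt R
  rw [hx.mem_pts_iff] at hR
  exact ⟨0 + j, _, sigmaVec_iterate_mem_classSpace hkn (span_sigmaVec_nu_le_classSpace hkn hR) j,
    hx.sigma_iterate j⟩

theorem IsPt.sigma_ne_self {k r : ℕ} (hkn : k ∣ n) (hk : k ≠ 1) {x : VStar K n} {P : SigStar K n}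
    (h : IsPt x P) (hx : x ∈ classSpace K n k r) : sigma F K n P ≠ P := by
  intro hP
  have h' := h.sigma_iterate (F := F) 1
  rw [Function.iterate_one, Function.iterate_one, hP] at h'
  obtain ⟨c, -, e⟩ := h.iff_exists_smul.1 h'
  have hmem : sigmaVec F K n x ∈ classSpace K n k r := e ▸ Submodule.smul_mem _ c hx
  have hmod := modEq_of_mem_classSpace h'.ne_zero (sigmaVec_mem_classSpace hkn hx) hmem
  refine hk (Nat.dvd_one.1 ?_)
  exact (Nat.modEq_zero_iff_dvd.1 (Nat.ModEq.add_left_cancel' r hmod))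

end Collineation

section Reconstruction

variable {F K : Type*} [Field F] [Fintype F] [Field K] [Algebra F K] {n k : ℕ}

variable (F K) in
/-- The subalgebra of the elements fixed by the `k`-th power of the Frobenius map, which is
`𝔽_{q^k}` if `k ∣ n`. -/
def frobFixed (k : ℕ) : Subalgebra F K :=
  AlgHom.equalizer (FiniteField.frobeniusAlgHom F K ^ k) (AlgHom.id F K)

theorem mem_frobFixed_iff {x : K} : x ∈ frobFixed F K k ↔ x ^ Fintype.card F ^ k = x := by
  rw [frobFixed, AlgHom.mem_equalizer, frobeniusAlgHom_pow_apply, AlgHom.id_apply]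

theorem finrank_frobFixed_le [Finite K] (hk : k ≠ 0) :
    Module.finrank F (frobFixed F K k) ≤ k := by
  have := Fintype.ofFinite (frobFixed F K k)
  have hq : 1 < Fintype.card F := Fintype.one_lt_card
  rw [← Nat.pow_le_pow_iff_right hq, ← Module.card_eq_pow_finrank, ← Nat.card_eq_fintype_card]
  refine le_trans (le_of_eq ?_) (ncard_setOf_pow_eq_self_le K (Nat.one_lt_pow hk hq))
  exact (Nat.card_coe_set_eq _).trans (congrArg _ (Set.ext fun _ => mem_frobFixed_iff))

theorem exists_direction_of_mem_subspread {W : Submodule F (K × K × F)}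
    (hW : pts F W ∩ hInf F K ∈ subspread F K k) :
    ∃ w : K × K, w ≠ 0 ∧ ∀ x ∈ W, x.2.2 = 0 → ∃ y ∈ frobFixed F K k, x = infVec F (y • w) := by
  obtain ⟨a, b, hab, hWD⟩ := hW
  refine ⟨(a, b), hab, fun x hx hx0 => ?_⟩
  obtain rfl | h0 := eq_or_ne x 0
  · exact ⟨0, zero_mem _, by rw [zero_smul, map_zero]⟩
  have hpt := isPt_mk (k := F) h0
  obtain ⟨y, hy, -, hy'⟩ := hWD ▸ show Projectivization.mk F x h0 ∈ pts F W ∩ hInf F K from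
    ⟨(hpt.mem_pts_iff W).2 hx, hpt.mem_hInf_iff.2 hx0⟩
  obtain ⟨c, -, rfl⟩ := hy'.iff_exists_smul.1 hpt
  refine ⟨c • y, Subalgebra.smul_mem _ (mem_frobFixed_iff.2 hy) c, ?_⟩
  simp [infVec, mul_comm]

/-- The points at infinity of the `k`-space span only a `(k - 1)`-space, whereas a normal rational
curve of degree `k` spans a `k`-space. -/
theorem exists_notMem_hInf [Finite K] {e : Fin (k + 1) → K × K × F} (hk : k ≠ 0)
    (hkq : k ≤ Nat.card F) (he : LinearIndependent F e) {W : Submodule F (K × K × F)}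
    (heW : nrc F e ⊆ pts F W) {w : K × K}
    (hW : ∀ x ∈ W, x.2.2 = 0 → ∃ y ∈ frobFixed F K k, x = infVec F (y • w)) :
    ∃ P ∈ nrc F e, P ∉ hInf F K := by
  by_contra! hinf
  let D : Submodule F (K × K × F) := (Subalgebra.toSubmodule (frobFixed F K k)).map
    (infVec F ∘ₗ (LinearMap.toSpanSingleton K (K × K) w).restrictScalars F)
  have hD : Module.finrank F D ≤ k :=
    (Submodule.finrank_map_le _ _).trans (finrank_frobFixed_le hk)
  have hsub : nrc F e ⊆ pts F D := by
    intro P hP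
    obtain ⟨x, hx⟩ := exists_isPt P
    obtain ⟨y, hy, rfl⟩ := hW x ((hx.mem_pts_iff W).1 (heW hP)) (hx.mem_hInf_iff.1 (hinf P hP))
    exact (hx.mem_pts_iff D).2 ⟨y, hy, rfl⟩
  have hspan := Submodule.finrank_mono (Submodule.span_le.2 ((nrc_subset_pts_iff hkq).1 hsub))
  rw [finrank_span_eq_card he, Fintype.card_fin] at hspan
  omega

variable [NeZero n]

/-- Parameters on the rational curve given by `f`: `p R` is a parameter of `ι R` for `R ∈ C`, and
the `r j` are those of `k` points at infinity in consecutive classes modulo `k`. -/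
structure IsConjugateParam (C : Set (Sig F K)) (f : Fin (k + 1) → VStar K n)
    (p : Sig F K → K × K) (r : Fin k → K × K) : Prop where
  isPt : ∀ R ∈ C, IsPt (nrcVec f (p R)) (iota F K n R)
  exists_mem_classSpace : ∃ s, ∀ j : Fin k, nrcVec f (r j) ∈ classSpace K n k (s + j)
  pairwise_cross_ne_zero : Pairwise fun i j => cross (r i) (r j) ≠ 0
  cross_ne_zero : ∀ R ∈ C, ∀ j, cross (p R) (r j) ≠ 0

theorem CondII.exists_isConjugateParam [Finite K] (hn : Module.finrank F K = n) (hkn : k ∣ n)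
    (hk : 2 ≤ k) {C : Set (Sig F K)} (h : CondII F K n k C) :
    ∃ (f : Fin (k + 1) → VStar K n) (p : Sig F K → K × K) (r : Fin k → K × K),
      IsConjugateParam C f p r := by
  obtain ⟨Cs, ⟨hCs, hsub⟩, Q, hQinj, hQ⟩ := h
  obtain ⟨-, -, f, -, rfl⟩ := isNRC_iff.1 hCs
  have hk0 : k ≠ 0 := by omega
  have hmem (j : Fin k) :
      (sigma F K n)^[j] Q ∈ nrc K f ∧ (sigma F K n)^[j] Q ∈ indicatorPoints F K n k :=
    hQ.ge ⟨j, j.2, rfl⟩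
  choose r hr using fun j : Fin k => (hmem j).1
  choose! p hp using fun R (hR : R ∈ C) => hsub (Set.mem_image_of_mem _ hR)
  obtain ⟨s, x, hx, hxQ⟩ := exists_mem_classSpace_of_mem_indicatorPoints hkn (hmem ⟨0, by omega⟩).2
  have hclass (j : Fin k) : nrcVec f (r j) ∈ classSpace K n k (s + j) := by
    obtain ⟨c, -, e⟩ := (hxQ.sigma_iterate (F := F) j).iff_exists_smul.1 (hr j)
    exact e ▸ Submodule.smul_mem _ c (sigmaVec_iterate_mem_classSpace hkn hx j)
  refine ⟨f, p, r, hp, ⟨s, hclass⟩, fun i j hij h => ?_, fun R hR j h => ?_⟩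
  · exact hij (Fin.ext (hQinj i.2 j.2 ((hr i).eq_of_cross_eq_zero hk0 (hr j) h)))
  · refine (hr j).sigma_ne_self (F := F) hkn (by omega) (hclass j) ?_
    rw [← (hp R hR).eq_of_cross_eq_zero hk0 (hr j) h, sigma_iota hn]

omit [NeZero n] in
theorem exists_functional (v : K × K) {w : K × K} (hw : w ≠ 0) (i : Fin n) :
    ∃ l : VStar K n →ₗ[K] K,
      (∀ y : K, l (iotaVec F K n (affVec F (v + y • w))) = y ^ Fintype.card F ^ (i : ℕ)) ∧
      ∀ z : VStar K n, z.1 i = 0 → z.2.1 i = 0 → z.2.2 = 0 → l z = 0 := by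
  obtain ⟨a, b, hab⟩ : ∃ a b : K, a * w.1 + b * w.2 = 1 := by
    by_cases h1 : w.1 = 0
    · have h2 : w.2 ≠ 0 := fun h2 => hw (Prod.ext h1 h2)
      exact ⟨0, w.2⁻¹, by simp [h2]⟩
    · exact ⟨w.1⁻¹, 0, by simp [h1]⟩
  let φ := FiniteField.frobeniusAlgHom F K ^ (i : ℕ)
  let c : VStar K n →ₗ[K] K := LinearMap.snd K _ K ∘ₗ LinearMap.snd K _ _
  let x : VStar K n →ₗ[K] K := LinearMap.proj i ∘ₗ LinearMap.fst K _ _ - φ v.1 • c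
  let x' : VStar K n →ₗ[K] K :=
    LinearMap.proj i ∘ₗ LinearMap.fst K _ _ ∘ₗ LinearMap.snd K _ _ - φ v.2 • c
  refine ⟨φ a • x + φ b • x', fun y => ?_, fun z h h' h0 => by simp [x, x', c, h, h', h0]⟩
  have hφ (z : K) : z ^ Fintype.card F ^ (i : ℕ) = φ z := (frobeniusAlgHom_pow_apply _ z).symm
  have hab' : φ a * φ w.1 + φ b * φ w.2 = 1 := by
    rw [← map_mul, ← map_mul, ← map_add, hab, map_one]
  simp only [x, x', c, iotaVec, affVec, LinearMap.coe_mk, AddHom.coe_mk, LinearMap.add_apply,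
    LinearMap.sub_apply, LinearMap.smul_apply, LinearMap.comp_apply, LinearMap.proj_apply,
    LinearMap.fst_apply, LinearMap.snd_apply, smul_eq_mul, hφ, Prod.fst_add, Prod.snd_add,
    Prod.smul_fst, Prod.smul_snd, map_add, map_mul, map_one]
  linear_combination φ y * hab'

namespace IsConjugateParam

variable {C : Set (Sig F K)} {f : Fin (k + 1) → VStar K n} {p : Sig F K → K × K}
  {r : Fin k → K × K}

theorem last_eq_zero (h : IsConjugateParam C f p r) (j : Fin k) : (nrcVec f (r j)).2.2 = 0 :=
  have ⟨_, hs⟩ := h.exists_mem_classSpace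
  (hs j).1

theorem exists_coord_eq_zero (h : IsConjugateParam C f p r) (hk : k ≠ 0) (i : Fin n) :
    ∃ j : Fin k, ∀ j' ≠ j, (nrcVec f (r j')).1 i = 0 ∧ (nrcVec f (r j')).2.1 i = 0 := by
  obtain ⟨s, hs⟩ := h.exists_mem_classSpace
  let j : Fin k := ⟨(i + (k - s % k)) % k, Nat.mod_lt _ (Nat.pos_of_ne_zero hk)⟩
  have hi : (i : ℕ) ≡ s + j [MOD k] := by
    have := (Nat.mod_lt s (Nat.pos_of_ne_zero hk)).le
    refine Nat.ModEq.symm (((Nat.mod_modEq _ k).add_left s).trans ?_)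
    refine ((Nat.mod_modEq s k).symm.add_right _).trans ?_
    rw [show s % k + (i + (k - s % k)) = i + k by omega]
    exact Nat.add_mod_right _ _
  refine ⟨j, fun j' hj' => (hs j').2 i fun hi' => hj' (Fin.ext ?_)⟩
  have hmod := Nat.ModEq.add_left_cancel' s (hi'.symm.trans hi)
  exact hmod.eq_of_lt_of_lt j'.2 j.2

theorem last_mul_prod_cross_eq (h : IsConjugateParam C f p r) {P : Sig F K} (hP : P ∈ C)
    (p' : K × K) : (nrcVec f p').2.2 * ∏ j, cross (p P) (r j) =
      (nrcVec f (p P)).2.2 * ∏ j, cross p' (r j) :=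
  mul_prod_cross_eq
    (comp_nrcVec_mem_binaryForms f (LinearMap.snd K (Fin n → K) K ∘ₗ LinearMap.snd K _ _))
    h.pairwise_cross_ne_zero h.last_eq_zero (h.cross_ne_zero P hP) p'

theorem exists_nrcVec_eq_smul (h : IsConjugateParam C f p r) {R : Sig F K} (hR : R ∈ C)
    {x : K × K × F} (hx : IsPt x R) :
    ∃ a : K, a ≠ 0 ∧ nrcVec f (p R) = a • iotaVec F K n x :=
  hx.iota.iff_exists_smul.1 (h.isPt R hR)

theorem notMem_hInf (h : IsConjugateParam C f p r) {P R : Sig F K} (hP : P ∈ C)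
    (hPinf : P ∉ hInf F K) (hR : R ∈ C) : R ∉ hInf F K := by
  obtain ⟨x, hx⟩ := exists_isPt P
  obtain ⟨y, hy⟩ := exists_isPt R
  obtain ⟨a, ha, hxP⟩ := h.exists_nrcVec_eq_smul hP hx
  obtain ⟨b, -, hyR⟩ := h.exists_nrcVec_eq_smul hR hy
  rw [hx.mem_hInf_iff] at hPinf
  rw [hy.mem_hInf_iff]
  intro hy0
  have hform := h.last_mul_prod_cross_eq hP (p R)
  have hprod : ∏ j, cross (p R) (r j) ≠ 0 :=
    Finset.prod_ne_zero_iff.2 fun j _ => h.cross_ne_zero R hR j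
  simp [hxP, hyR, iotaVec, hy0, ha, hPinf, hprod] at hform

theorem exists_pow_mul_cross_eq (h : IsConjugateParam C f p r) (hk : k ≠ 0) {v w : K × K}
    (hw : w ≠ 0) (hv : affPt F v ∈ C) (i : Fin n) :
    ∃ j c, ∀ y : K, affPt F (v + y • w) ∈ C →
      y ^ Fintype.card F ^ (i : ℕ) * cross (p (affPt F (v + y • w))) (r j) =
        c * cross (p (affPt F (v + y • w))) (p (affPt F v)) := by
  obtain ⟨l, hl, hl0⟩ := exists_functional (F := F) v hw i
  let l' : VStar K n →ₗ[K] K := LinearMap.snd K (Fin n → K) K ∘ₗ LinearMap.snd K _ _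
  have hl' (x : K × K) : l' (iotaVec F K n (affVec F x)) = 1 := map_one (algebraMap F K)
  obtain ⟨j, hj⟩ := h.exists_coord_eq_zero hk i
  obtain ⟨a, ha, hav⟩ := h.exists_nrcVec_eq_smul hv (isPt_affPt v)
  have hlv : l (nrcVec f (p (affPt F v))) = 0 := by
    have := hl 0
    rw [zero_smul, add_zero, zero_pow (pow_ne_zero _ Fintype.card_ne_zero)] at this
    rw [hav, map_smul, this, smul_zero]
  have hlv' : l' (nrcVec f (p (affPt F v))) ≠ 0 := by
    rwa [hav, map_smul, hl', smul_eq_mul, mul_one]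
  obtain ⟨c, hc⟩ := exists_forall_mul_cross_eq (comp_nrcVec_mem_binaryForms f l)
    (comp_nrcVec_mem_binaryForms f l') h.pairwise_cross_ne_zero h.last_eq_zero
    (h.cross_ne_zero _ hv) hlv'
    (fun j' hj' => hl0 _ (hj j' hj').1 (hj j' hj').2 (h.last_eq_zero j')) hlv
  refine ⟨j, c, fun y hy => ?_⟩
  obtain ⟨b, hb, hbR⟩ := h.exists_nrcVec_eq_smul hy (isPt_affPt _)
  have hR := hc (p (affPt F (v + y • w)))
  rw [hbR, map_smul, map_smul, hl, hl', smul_eq_mul, smul_eq_mul] at hR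
  exact mul_left_cancel₀ hb (by linear_combination hR)

theorem exists_inv_pow_card_eq (h : IsConjugateParam C f p r) (hn : 2 ≤ n) (hk : k ≠ 0)
    {v w : K × K} (hw : w ≠ 0) (hv : affPt F v ∈ C) :
    ∃ A B : K, ∀ y ≠ 0, affPt F (v + y • w) ∈ C → y⁻¹ ^ Fintype.card F = A * y⁻¹ + B := by
  obtain ⟨j, c, h0⟩ := h.exists_pow_mul_cross_eq hk hw hv ⟨0, by omega⟩
  obtain ⟨j', c', h1⟩ := h.exists_pow_mul_cross_eq hk hw hv ⟨1, by omega⟩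
  set p₀ := p (affPt F v)
  refine ⟨c * cross p₀ (r j') / (c' * cross p₀ (r j)), cross (r j') (r j) / (c' * cross p₀ (r j)),
    fun y hy hyC => ?_⟩
  specialize h0 y hyC
  specialize h1 y hyC
  rw [pow_zero, pow_one] at h0
  rw [pow_one] at h1
  set p₁ := p (affPt F (v + y • w))
  have hp₀ : cross p₀ (r j) ≠ 0 := h.cross_ne_zero _ hv j
  have hyq : y ^ Fintype.card F ≠ 0 := pow_ne_zero _ hy
  have hne : c' * cross p₁ p₀ ≠ 0 := h1 ▸ mul_ne_zero hyq (h.cross_ne_zero _ hyC j')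
  have hc' := left_ne_zero_of_mul hne
  have plucker : cross p₁ (r j') * cross p₀ (r j) =
      cross p₁ (r j) * cross p₀ (r j') + cross (r j') (r j) * cross p₁ p₀ := by
    simp only [cross]
    ring
  refine mul_right_cancel₀ (right_ne_zero_of_mul hne) ?_
  rw [inv_pow]
  generalize y ^ Fintype.card F = z at h1 hyq
  field_simp
  linear_combination -y * cross p₀ (r j) * h1 + y * z * plucker + z * cross p₀ (r j') * h0

end IsConjugateParam

omit [NeZero n] in
theorem eq_range_of_forall_pow_card_eq [Finite K] {S : Set K} (hS : Fintype.card F ≤ S.ncard)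
    {A B : K} (h : ∀ x ∈ S, x ^ Fintype.card F = A * x + B) :
    ∃ d ≠ 0, ∃ x₀, S = Set.range fun t : F => algebraMap F K t * d + x₀ := by
  have hcard : 1 < S.ncard := Fintype.one_lt_card.trans_le hS
  obtain ⟨x₀, hx₀, x₁, hx₁, hne⟩ := (Set.one_lt_ncard).1 hcard
  have hd : x₁ - x₀ ≠ 0 := sub_ne_zero.2 hne.symm
  refine ⟨x₁ - x₀, hd, x₀, Set.eq_of_subset_of_ncard_le (fun x hx => ?_) ?_⟩
  · have hfrob (x y : K) : (x - y) ^ Fintype.card F = x ^ Fintype.card F - y ^ Fintype.card F :=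
      map_sub (FiniteField.frobeniusAlgHom F K) x y
    have hfix : ((x - x₀) / (x₁ - x₀)) ^ Nat.card (algebraMap F K).fieldRange =
        (x - x₀) / (x₁ - x₀) := by
      have hA : A ≠ 0 := by
        rintro rfl
        refine pow_ne_zero (Fintype.card F) hd ?_
        rw [hfrob, h _ hx₀, h _ hx₁]
        ring
      rw [card_fieldRange, Nat.card_eq_fintype_card, div_pow, hfrob, hfrob, h _ hx, h _ hx₀,
        h _ hx₁, add_sub_add_right_eq_sub, add_sub_add_right_eq_sub, ← mul_sub, ← mul_sub,
        mul_div_mul_left _ _ hA]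
    obtain ⟨t, ht⟩ := (mem_subfield_iff_pow_eq_self _).2 hfix
    exact ⟨t, by simp only [ht, div_mul_cancel₀ _ hd, sub_add_cancel]⟩
  · rw [← Set.image_univ]
    exact ((Set.ncard_image_le).trans_eq
      (by rw [Set.ncard_univ, Nat.card_eq_fintype_card])).trans hS

omit [NeZero n] in
theorem exists_eq_image_affineSubline [Finite K] {C : Set (Sig F K)} {v w : K × K} (hw : w ≠ 0)
    (hv : affPt F v ∈ C) (hline : ∀ R ∈ C, ∃ y : K, R = affPt F (v + y • w))
    (hcard : Fintype.card F + 1 ≤ C.ncard) {A B : K}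
    (h : ∀ y ≠ 0, affPt F (v + y • w) ∈ C → y⁻¹ ^ Fintype.card F = A * y⁻¹ + B) :
    ∃ w' θ, w' ≠ 0 ∧ θ ∉ (algebraMap F K).fieldRange ∧ C = affPt F '' affineSubline F v w' θ := by
  let S : Set K := {x | x ≠ 0 ∧ affPt F (v + x⁻¹ • w) ∈ C}
  have hCS : C = insert (affPt F v) ((fun x => affPt F (v + x⁻¹ • w)) '' S) := by
    refine Set.Subset.antisymm (fun R hR => ?_) (Set.insert_subset hv ?_)
    · obtain ⟨y, rfl⟩ := hline R hR
      obtain rfl | hy := eq_or_ne y 0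
      · left
        rw [zero_smul, add_zero]
      · exact Or.inr ⟨y⁻¹, ⟨inv_ne_zero hy, by rwa [inv_inv]⟩, by simp only [inv_inv]⟩
    · rintro _ ⟨x, hx, rfl⟩
      exact hx.2
  have hS : Fintype.card F ≤ S.ncard := by
    have := Set.ncard_insert_le (affPt F v) ((fun x => affPt F (v + x⁻¹ • w)) '' S)
    rw [← hCS] at this
    have := Set.ncard_image_le (f := fun x => affPt F (v + x⁻¹ • w)) S.toFinite
    omega
  obtain ⟨d, hd, x₀, hSd⟩ := eq_range_of_forall_pow_card_eq hS fun x hx => by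
    simpa only [inv_inv] using h x⁻¹ (inv_ne_zero hx.1) hx.2
  have hθ (t : F) : algebraMap F K t - -x₀ / d = (algebraMap F K t * d + x₀) / d := by
    field_simp
    ring
  refine ⟨d⁻¹ • w, -x₀ / d, smul_ne_zero (inv_ne_zero hd) hw, ?_, ?_⟩
  · rintro ⟨t, ht⟩
    refine (hSd.ge ⟨t, rfl⟩).1 ((div_eq_zero_iff.1 ?_).resolve_right hd)
    rw [← hθ, ht, sub_self]
  · rw [hCS, hSd, affineSubline, Set.image_insert_eq, ← Set.range_comp, ← Set.range_comp]
    congr 2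
    funext t
    simp only [Function.comp_apply, hθ, smul_smul, ← mul_inv, div_mul_cancel₀ _ hd]

theorem exists_affineSubline_of_cond [Finite K] (hn : Module.finrank F K = n) (hkn : k ∣ n)
    {C : Set (Sig F K)} (h1 : CondI F K k C) (h2 : CondII F K n k C) :
    ∃ v w θ, w ≠ 0 ∧ θ ∉ (algebraMap F K).fieldRange ∧
      C = affPt F '' affineSubline F v w θ := by
  obtain ⟨hC, W, -, hCW, hW⟩ := h1
  obtain ⟨hk, hkq, e, he, rfl⟩ := isNRC_iff.1 hC
  have hk0 : k ≠ 0 := by omega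
  obtain ⟨w, hw, hdir⟩ := exists_direction_of_mem_subspread hW
  obtain ⟨P, hP, hPinf⟩ := exists_notMem_hInf hk0 hkq he hCW hdir
  obtain ⟨f, p, r, h⟩ := h2.exists_isConjugateParam hn hkn hk
  have haff {R} (hR : R ∈ nrc F e) : ∃ x, affPt F x = R :=
    exists_affPt_eq_of_notMem_hInf (h.notMem_hInf hP hPinf hR)
  have hmemW {x : K × K} (hx : affPt F x ∈ nrc F e) : affVec F x ∈ W :=
    ((isPt_affPt x).mem_pts_iff W).1 (hCW hx)
  obtain ⟨v, rfl⟩ := haff hP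
  have hline (R) (hR : R ∈ nrc F e) : ∃ y : K, R = affPt F (v + y • w) := by
    obtain ⟨x, rfl⟩ := haff hR
    obtain ⟨y, -, hy⟩ := hdir _ (W.sub_mem (hmemW hR) (hmemW hP)) (sub_self 1)
    refine ⟨y, congrArg (affPt F) ?_⟩
    rw [← sub_eq_iff_eq_add']
    refine infVec_injective (k := F) (hy ▸ ?_)
    simp [infVec, affVec]
  have hn2 : 2 ≤ n := hk.trans (Nat.le_of_dvd (Nat.pos_of_ne_zero (NeZero.ne n)) hkn)
  obtain ⟨A, B, hAB⟩ := h.exists_inv_pow_card_eq hn2 hk0 hw hP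
  have hcard : Fintype.card F + 1 ≤ (nrc F e).ncard := by
    rw [ncard_nrc hk0 he, Nat.card_eq_fintype_card]
  exact ⟨v, exists_eq_image_affineSubline hw hP hline hcard hAB⟩

end Reconstruction

section Conjugates

open Polynomial IntermediateField

variable {F K : Type*} [Field F] [Fintype F] [Field K] [Algebra F K] [Finite K]

theorem card_toSubfield_adjoin_simple (θ : K) :
    Nat.card F⟮θ⟯.toSubfield = Fintype.card F ^ (minpoly F θ).natDegree := by
  have := Fintype.ofFinite F⟮θ⟯
  rw [← adjoin.finrank (Algebra.IsIntegral.isIntegral (R := F) θ),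
    ← Module.card_eq_pow_finrank (K := F) (V := F⟮θ⟯), ← Nat.card_eq_fintype_card]
  rfl

theorem mem_adjoin_simple_iff_pow_eq_self (θ : K) {x : K} :
    x ∈ F⟮θ⟯ ↔ x ^ Fintype.card F ^ (minpoly F θ).natDegree = x := by
  rw [← card_toSubfield_adjoin_simple, ← mem_subfield_iff_pow_eq_self, mem_toSubfield]

theorem pow_card_pow_eq_pow_card_pow_iff (θ : K) (i j : ℕ) :
    θ ^ Fintype.card F ^ i = θ ^ Fintype.card F ^ j ↔ i ≡ j [MOD (minpoly F θ).natDegree] := by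
  let φ := FiniteField.frobeniusAlgEquivOfAlgebraic F F⟮θ⟯
  have hφ (m : ℕ) : ((φ ^ m) (AdjoinSimple.gen F θ) : K) = θ ^ Fintype.card F ^ m := by
    simp [φ, AlgEquiv.coe_pow, FiniteField.coe_frobeniusAlgEquivOfAlgebraic_iterate]
  rw [← adjoin.finrank (Algebra.IsIntegral.isIntegral (R := F) θ),
    ← FiniteField.orderOf_frobeniusAlgEquivOfAlgebraic F F⟮θ⟯, ← pow_eq_pow_iff_modEq, ← hφ, ← hφ,
    Subtype.coe_inj]
  refine ⟨fun h => AlgEquiv.coe_toAlgHom_injective (algHom_ext_of_eq_adjoin _ rfl ?_), fun h => ?_⟩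
  · rintro _ rfl
    exact h
  · exact congrArg (fun ψ : F⟮θ⟯ ≃ₐ[F] F⟮θ⟯ => ψ (AdjoinSimple.gen F θ)) h

theorem aeval_minpoly_eq_zero_iff {θ t : K} : aeval t (minpoly F θ) = 0 ↔
    ∃ j < (minpoly F θ).natDegree, t = θ ^ Fintype.card F ^ j := by
  have hint := Algebra.IsIntegral.isIntegral (R := F) θ
  constructor
  · intro h
    obtain ⟨σ, rfl⟩ := minpoly.exists_algEquiv_of_root' hint.isAlgebraic h
    obtain ⟨j, rfl⟩ := (FiniteField.bijective_frobeniusAlgEquivOfAlgebraic_pow F K).2 σ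
    refine ⟨j % (minpoly F θ).natDegree, Nat.mod_lt _ (minpoly.natDegree_pos hint), ?_⟩
    rw [(pow_card_pow_eq_pow_card_pow_iff θ _ _).2 (Nat.mod_modEq _ _), AlgEquiv.coe_pow,
      FiniteField.coe_frobeniusAlgEquivOfAlgebraic_iterate]
  · rintro ⟨j, -, rfl⟩
    rw [← frobeniusAlgHom_pow_apply, aeval_algHom_apply, minpoly.aeval, map_zero]

end Conjugates

section MinpolyCurve

open Polynomial

variable {F K : Type*} [Field F] [Field K] [Algebra F K] {θ : K}

variable (F) in
/-- The vectors defining the image of `affineSubline F v w θ` as a normal rational curve of degree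
`[F(θ) : F]`, obtained by clearing the denominator `t - θ` with the minimal polynomial of `θ`. -/
def curveVec (v w : K × K) (θ : K) (i : Fin ((minpoly F θ).natDegree + 1)) : K × K × F :=
  (minpoly F θ).coeff i • affVec F v + infVec F ((minpolyDiv F θ).coeff i • w)

theorem sum_veronese_mul_coeff {R k : Type*} [Semiring R] [Field k] (φ : R →+* k) {p : R[X]}
    {d : ℕ} (hp : p.natDegree ≤ d) (t : k) :
    ∑ i, veronese d (1, t) i * φ (p.coeff i) = p.eval₂ φ t := by
  rw [eval₂_eq_sum_range' φ (Nat.lt_succ_of_le hp), Finset.sum_range]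
  exact Finset.sum_congr rfl fun i _ => by rw [veronese, one_pow, one_mul, mul_comm]

theorem curveVec_last (hθ : IsIntegral F θ) (v w : K × K) :
    curveVec F v w θ (Fin.last _) = affVec F v := by
  rw [curveVec, Fin.val_last, coeff_eq_zero_of_natDegree_lt (natDegree_minpolyDiv_lt hθ),
    (minpoly.monic hθ).coeff_natDegree, one_smul, zero_smul, map_zero, add_zero]

theorem nrcVec_curveVec (hθ : IsIntegral F θ) (v w : K × K) (t : F) :
    nrcVec (curveVec F v w θ) (1, t) = (minpoly F θ).eval t • affVec F v +
      infVec F ((minpolyDiv F θ).eval (algebraMap F K t) • w) := by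
  have hm := sum_veronese_mul_coeff (RingHom.id F) (p := minpoly F θ) le_rfl t
  have hg := sum_veronese_mul_coeff (RingHom.id K) (natDegree_minpolyDiv_lt hθ).le
    (algebraMap F K t)
  rw [eval, eval, ← hm, ← hg]
  simp only [nrcVec, curveVec, smul_add, Finset.sum_add_distrib, Finset.sum_smul, map_sum,
    smul_smul, RingHom.id_apply]
  congr 1
  refine Finset.sum_congr rfl fun i _ => ?_
  rw [← map_smul, ← algebraMap_smul K (veronese _ _ i), smul_smul]
  simp [veronese]

theorem nrc_curveVec (hint : IsIntegral F θ) (hθ : θ ∉ (algebraMap F K).fieldRange)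
    (v w : K × K) : nrc F (curveVec F v w θ) = affPt F '' affineSubline F v w θ := by
  have hvec (t : F) : nrcVec (curveVec F v w θ) (1, t) =
      (minpoly F θ).eval t • affVec F (v + (algebraMap F K t - θ)⁻¹ • w) := by
    have hne : algebraMap F K t - θ ≠ 0 := fun h => hθ ⟨t, sub_eq_zero.1 h⟩
    have hdiv : (minpolyDiv F θ).eval (algebraMap F K t) =
        (minpoly F θ).eval t • (algebraMap F K t - θ)⁻¹ := by
      rw [Algebra.smul_def, ← aeval_algebraMap_apply_eq_algebraMap_eval, ← eval_map_algebraMap,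
        ← minpolyDiv_spec F θ, eval_mul, eval_sub, eval_X, eval_C, mul_inv_cancel_right₀ hne]
    rw [nrcVec_curveVec hint, hdiv, smul_assoc, map_smul, ← smul_add]
    congr 1
    simp [affVec, infVec]
  have h0 (t : F) : (minpoly F θ).eval t ≠ 0 := fun h => hθ ⟨t, minpoly.root hint h⟩
  ext P
  rw [mem_nrc_iff, curveVec_last hint, affineSubline, Set.image_insert_eq, Set.mem_insert_iff,
    ← Set.range_comp, Set.mem_range]
  simp only [hvec, isPt_smul_iff (h0 _)]
  have hP (x : K × K) : IsPt (affVec F x) P ↔ affPt F x = P :=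
    ⟨(isPt_affPt x).unique, fun h => h ▸ isPt_affPt x⟩
  exact or_congr ((hP v).trans eq_comm) (exists_congr fun t => hP _)

theorem aeval_derivative_minpoly_ne_zero [PerfectField F] (hθ : IsIntegral F θ) :
    aeval θ (derivative (minpoly F θ)) ≠ 0 :=
  (PerfectField.separable_of_irreducible (minpoly.irreducible hθ)).aeval_derivative_ne_zero
    (minpoly.aeval F θ)

end MinpolyCurve

section ConjugatePoints

variable {F K : Type*} [Fintype F] [Field K] {n k : ℕ}

variable (F n) in
/-- The vector of the point at infinity `Q^{σ^j}`, where `Q ∈ Π` has the coordinates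
`w^{q^i}` for `i` divisible by `k`. -/
def conjVec (k : ℕ) (w : K × K) (j : ℕ) : VStar K n :=
  (fun i => if (i : ℕ) ≡ j [MOD k] then w.1 ^ Fintype.card F ^ (i : ℕ) else 0,
    fun i => if (i : ℕ) ≡ j [MOD k] then w.2 ^ Fintype.card F ^ (i : ℕ) else 0, 0)

theorem conjVec_mem_classSpace (w : K × K) (j : ℕ) : conjVec F n k w j ∈ classSpace K n k j :=
  ⟨rfl, fun _ hi => ⟨if_neg hi, if_neg hi⟩⟩

theorem conjVec_self (w : K × K) : conjVec F n k w k = conjVec F n k w 0 := by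
  have h (i : ℕ) : i ≡ k [MOD k] ↔ i ≡ 0 [MOD k] := by simp [Nat.ModEq]
  simp only [conjVec, h]

variable [Field F] [Algebra F K] [NeZero n]

theorem sigmaVec_conjVec [Finite K] (hn : Module.finrank F K = n) (hkn : k ∣ n) (w : K × K)
    (j : ℕ) : sigmaVec F K n (conjVec F n k w j) = conjVec F n k w (j + 1) := by
  have hcoord (x : K) (i : Fin n) :
      (if ((i - 1 : Fin n) : ℕ) ≡ j [MOD k] then
        x ^ Fintype.card F ^ ((i - 1 : Fin n) : ℕ) else 0) ^ Fintype.card F =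
      if (i : ℕ) ≡ j + 1 [MOD k] then x ^ Fintype.card F ^ (i : ℕ) else 0 := by
    have hi := val_sub_one_add_one_modEq i
    have hiff : ((i - 1 : Fin n) : ℕ) ≡ j [MOD k] ↔ (i : ℕ) ≡ j + 1 [MOD k] :=
      ⟨fun h => (hi.of_dvd hkn).symm.trans (h.add_right 1),
        fun h => Nat.ModEq.add_right_cancel' 1 ((hi.of_dvd hkn).trans h)⟩
    have hpow : x ^ Fintype.card F ^ (((i - 1 : Fin n) : ℕ) + 1) = x ^ Fintype.card F ^ (i : ℕ) :=
      pow_card_pow_eq_of_modEq (hn ▸ hi) x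
    rw [if_congr hiff rfl rfl, ite_pow, zero_pow Fintype.card_ne_zero, ← pow_mul, ← pow_succ, hpow]
  exact Prod.ext (funext (hcoord _)) (Prod.ext (funext (hcoord _))
    (zero_pow Fintype.card_ne_zero))

theorem IsPt.sigma_iterate_conjVec [Finite K] (hn : Module.finrank F K = n) (hkn : k ∣ n)
    {w : K × K} {Q : SigStar K n} (h : IsPt (conjVec F n k w 0) Q) (j : ℕ) :
    IsPt (conjVec F n k w j) ((sigma F K n)^[j] Q) := by
  have hj : (sigmaVec F K n)^[j] (conjVec F n k w 0) = conjVec F n k w j := by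
    induction j with
    | zero => rfl
    | succ j ih => rw [Function.iterate_succ_apply', ih, sigmaVec_conjVec hn hkn]
  exact hj ▸ h.sigma_iterate j

theorem sigmaVec_single (x : K × K) (i : Fin n) :
    sigmaVec F K n (Pi.single i x.1, Pi.single i x.2, 0) =
      (Pi.single (i + 1) (x.1 ^ Fintype.card F), Pi.single (i + 1) (x.2 ^ Fintype.card F), 0) := by
  have hcoord (y : K) (j : Fin n) : (Pi.single i y : Fin n → K) (j - 1) ^ Fintype.card F =
      (Pi.single (i + 1) (y ^ Fintype.card F) : Fin n → K) j := by
    simp only [Pi.single_apply, sub_eq_iff_eq_add, ite_pow, zero_pow Fintype.card_ne_zero]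
  exact Prod.ext (funext (hcoord _)) (Prod.ext (funext (hcoord _))
    (zero_pow Fintype.card_ne_zero))

theorem sigmaVec_iterate_single (w : K × K) (m : ℕ) :
    (sigmaVec F K n)^[m] (Pi.single 0 w.1, Pi.single 0 w.2, 0) =
      (Pi.single (Fin.ofNat n m) (w.1 ^ Fintype.card F ^ m),
        Pi.single (Fin.ofNat n m) (w.2 ^ Fintype.card F ^ m), 0) := by
  induction m with
  | zero => simp
  | succ m ih =>
    have hm : Fin.ofNat n (m + 1) = Fin.ofNat n m + 1 := by
      ext
      simp [Fin.val_add]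
    rw [Function.iterate_succ_apply', ih, hm, pow_succ, pow_mul, pow_mul]
    exact sigmaVec_single (_, _) _

theorem single_mem_nu (w : K × K) : (Pi.single 0 w.1, Pi.single 0 w.2, 0) ∈ nu K n := by
  have h : ((Pi.single 0 w.1, Pi.single 0 w.2, 0) : VStar K n) =
      w.1 • (Pi.single 0 1, 0, 0) + w.2 • (0, Pi.single 0 1, 0) := by
    simp [← Pi.single_smul]
  rw [h]
  exact add_mem (Submodule.smul_mem _ _ (Submodule.subset_span (Or.inl rfl)))
    (Submodule.smul_mem _ _ (Submodule.subset_span (Or.inr rfl)))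

theorem conjVec_mem_span_sigmaVec_nu (hkn : k ∣ n) (w : K × K) :
    conjVec F n k w 0 ∈ Submodule.span K
      {y | ∃ r < n / k, ∃ x ∈ nu K n, y = (sigmaVec F K n)^[k * r] x} := by
  have hcoord (g : Fin n → K) : (fun i : Fin n => if (i : ℕ) ≡ 0 [MOD k] then g i else 0) =
      ∑ i : Fin n, if (i : ℕ) ≡ 0 [MOD k] then Pi.single i (g i) else 0 := by
    rw [← Finset.univ_sum_single fun i : Fin n => if (i : ℕ) ≡ 0 [MOD k] then g i else 0]
    exact Finset.sum_congr rfl fun i _ => by split_ifs <;> simp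
  have hsum : conjVec F n k w 0 = ∑ i : Fin n, if (i : ℕ) ≡ 0 [MOD k] then
      (sigmaVec F K n)^[(i : ℕ)] (Pi.single 0 w.1, Pi.single 0 w.2, 0) else 0 := by
    simp only [conjVec, hcoord, sigmaVec_iterate_single, Fin.ofNat_val_eq_self]
    ext1 <;> [skip; ext1] <;>
      simp only [Prod.fst_sum, Prod.snd_sum, apply_ite, Prod.fst_zero, Prod.snd_zero]
    simp
  rw [hsum]
  refine sum_mem fun i _ => ?_
  split_ifs with hi
  · obtain ⟨r, hr⟩ := Nat.modEq_zero_iff_dvd.1 hi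
    rw [hr]
    exact Submodule.subset_span ⟨r, Nat.lt_of_mul_lt_mul_left (a := k) (by
      rw [← hr, Nat.mul_div_cancel' hkn]
      exact i.2), _, single_mem_nu w, rfl⟩
  · exact zero_mem _

end ConjugatePoints

section ExtendedCurve

open Polynomial

variable {F K : Type*} [Field F] [Fintype F] [Field K] [Algebra F K] {n : ℕ}

theorem iotaVec_nrcVec {d : ℕ} (e : Fin (d + 1) → K × K × F) (p : F × F) :
    iotaVec F K n (nrcVec e p) =
      nrcVec (iotaVec F K n ∘ e) (algebraMap F K p.1, algebraMap F K p.2) := by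
  simp only [nrcVec, map_sum, map_smulₛₗ, veronese, map_mul, map_pow, Function.comp_apply]

theorem nrcVec_iotaVec_curveVec {θ : K} (hint : IsIntegral F θ) (v w : K × K) (t : K) :
    nrcVec (iotaVec F K n ∘ curveVec F v w θ) (1, t) =
      aeval t (minpoly F θ) • iotaVec F K n (affVec F v) +
        (fun i : Fin n => (minpolyDiv F θ).eval₂ (FiniteField.frobeniusAlgHom F K ^ (i : ℕ)) t *
            w.1 ^ Fintype.card F ^ (i : ℕ),
          fun i : Fin n => (minpolyDiv F θ).eval₂ (FiniteField.frobeniusAlgHom F K ^ (i : ℕ)) t *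
            w.2 ^ Fintype.card F ^ (i : ℕ), 0) := by
  have hg (j : ℕ) := sum_veronese_mul_coeff (FiniteField.frobeniusAlgHom F K ^ j : K →ₐ[F] K)
    (natDegree_minpolyDiv_lt hint).le t
  rw [aeval_def, ← sum_veronese_mul_coeff (algebraMap F K) le_rfl]
  simp only [nrcVec, curveVec, Function.comp_apply, map_add, map_smulₛₗ, smul_add,
    Finset.sum_add_distrib, smul_smul, Finset.sum_smul, ← hg]
  congr 1
  refine Prod.ext (funext fun j => ?_) (Prod.ext (funext fun j => ?_) ?_)
  all_goals simp [infVec, iotaVec, Prod.fst_sum, Prod.snd_sum, Finset.sum_mul, mul_pow, mul_assoc,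
    frobeniusAlgHom_pow_apply]

variable [Finite K] (v w : K × K) (θ : K)

theorem nrcVec_iotaVec_curveVec_pow (j : ℕ) :
    nrcVec (iotaVec F K n ∘ curveVec F v w θ) (1, θ ^ Fintype.card F ^ j) =
      aeval θ (derivative (minpoly F θ)) ^ Fintype.card F ^ j •
        conjVec F n (minpoly F θ).natDegree w j := by
  classical
  have hroot : aeval (θ ^ Fintype.card F ^ j) (minpoly F θ) = 0 := by
    rw [← frobeniusAlgHom_pow_apply, aeval_algHom_apply, minpoly.aeval, map_zero]
  have heval (i : ℕ) : (minpolyDiv F θ).eval₂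
      (FiniteField.frobeniusAlgHom F K ^ i) (θ ^ Fintype.card F ^ j) =
        if i ≡ j [MOD (minpoly F θ).natDegree] then
          aeval θ (derivative (minpoly F θ)) ^ Fintype.card F ^ j else 0 := by
    rw [← frobeniusAlgHom_pow_apply, eval₂_minpolyDiv_self, ← aeval_algHom_apply,
      ← frobeniusAlgHom_pow_apply, ← aeval_algHom_apply, frobeniusAlgHom_pow_apply,
      frobeniusAlgHom_pow_apply]
    exact ite_congr (propext (pow_card_pow_eq_pow_card_pow_iff θ i j)) (fun h => by
      rw [(pow_card_pow_eq_pow_card_pow_iff θ i j).2 h]) fun _ => rfl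
  rw [nrcVec_iotaVec_curveVec (Algebra.IsIntegral.isIntegral θ), hroot, zero_smul, zero_add]
  simp only [heval, conjVec, Prod.smul_mk, smul_zero]
  congr 2 <;> ext i <;> simp [ite_mul]

end ExtendedCurve

section Independence

open Polynomial

variable {F K : Type*} [Field F] [Fintype F] [Field K] [Algebra F K] {n : ℕ}

omit [Field F] [Algebra F K] in
theorem linearIndependent_conjVec {k : ℕ} (hkn : k ≤ n) {w : K × K} (hw : w ≠ 0) :
    LinearIndependent K fun j : Fin k => conjVec F n k w j := by
  rw [Fintype.linearIndependent_iff]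
  intro g hg j
  have hcoord (x : K) : ∑ i : Fin k, g i * (if (j : ℕ) ≡ i [MOD k] then
      x ^ Fintype.card F ^ (j : ℕ) else 0) = g j * x ^ Fintype.card F ^ (j : ℕ) := by
    rw [Finset.sum_eq_single_of_mem j (Finset.mem_univ j) fun i _ hij => ?_,
      if_pos (Nat.ModEq.refl _)]
    rw [if_neg fun h => hij (Fin.ext (h.eq_of_lt_of_lt j.2 i.2).symm), mul_zero]
  have h1 : g j * w.1 ^ Fintype.card F ^ (j : ℕ) = 0 := by
    rw [← hcoord]
    simpa [conjVec, Prod.fst_sum] using congrFun (congrArg Prod.fst hg) (j.castLE hkn)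
  have h2 : g j * w.2 ^ Fintype.card F ^ (j : ℕ) = 0 := by
    rw [← hcoord]
    simpa [conjVec, Prod.fst_sum, Prod.snd_sum] using
      congrFun (congrArg (fun x => x.2.1) hg) (j.castLE hkn)
  by_contra h
  exact hw (Prod.ext (eq_zero_of_pow_eq_zero ((mul_eq_zero.1 h1).resolve_left h))
    (eq_zero_of_pow_eq_zero ((mul_eq_zero.1 h2).resolve_left h)))

theorem linearIndependent_cons_conjVec {k : ℕ} (hkn : k ≤ n) (v : K × K) {w : K × K} (hw : w ≠ 0) :
    LinearIndependent K
      (Fin.cons (iotaVec F K n (affVec F v)) fun j : Fin k => conjVec F n k w j :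
        Fin (k + 1) → VStar K n) := by
  refine linearIndependent_finCons.2 ⟨linearIndependent_conjVec hkn hw, fun h => ?_⟩
  have hle : Submodule.span K (Set.range fun j : Fin k => conjVec F n k w j) ≤
      LinearMap.ker (LinearMap.snd K (Fin n → K) K ∘ₗ LinearMap.snd K (Fin n → K) _) := by
    rw [Submodule.span_le]
    rintro _ ⟨j, rfl⟩
    rfl
  exact one_ne_zero ((map_one (algebraMap F K)).symm.trans (hle h))

variable [Finite K] (v : K × K) {w : K × K} (hw : w ≠ 0) (θ : K)
include hw

/-- The span contains the `k + 1` independent vectors `ι(v, 1)` and the values at the roots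
`θ^{q^j}` of the minimal polynomial. -/
theorem linearIndependent_iotaVec_curveVec (hkn : (minpoly F θ).natDegree ≤ n) :
    LinearIndependent K (iotaVec F K n ∘ curveVec F v w θ) := by
  have hint := Algebra.IsIntegral.isIntegral (R := F) θ
  set e := iotaVec F K n ∘ curveVec F v w θ with he
  rw [linearIndependent_iff_card_le_finrank_span, Fintype.card_fin]
  have hlast : iotaVec F K n (affVec F v) ∈ Submodule.span K (Set.range e) :=
    Submodule.subset_span ⟨Fin.last _, by rw [he, Function.comp_apply, curveVec_last hint]⟩
  have hconj (j : ℕ) :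
      conjVec F n (minpoly F θ).natDegree w j ∈ Submodule.span K (Set.range e) := by
    have hmem : nrcVec e (1, θ ^ Fintype.card F ^ j) ∈ Submodule.span K (Set.range e) :=
      sum_mem fun i _ => Submodule.smul_mem _ _ (Submodule.subset_span (Set.mem_range_self i))
    rw [nrcVec_iotaVec_curveVec_pow] at hmem
    exact (Submodule.smul_mem_iff _
      (pow_ne_zero _ (aeval_derivative_minpoly_ne_zero hint))).1 hmem
  have hle := Submodule.finrank_mono (Submodule.span_le.2 (Set.insert_subset hlast
    (Set.range_subset_iff.2 fun j : Fin (minpoly F θ).natDegree => hconj j)))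
  rwa [← Fin.range_cons, finrank_span_eq_card (linearIndependent_cons_conjVec hkn v hw),
    Fintype.card_fin] at hle

omit [Fintype F] in
theorem linearIndependent_curveVec : LinearIndependent F (curveVec F v w θ) := by
  have : Finite F := Finite.of_injective _ (algebraMap F K).injective
  have := Fintype.ofFinite F
  rw [Fintype.linearIndependent_iff]
  intro g hg i
  have hι := congrArg (iotaVec F K (Module.finrank F K)) hg
  simp only [map_sum, map_smulₛₗ, map_zero] at hι
  exact (map_eq_zero (algebraMap F K)).1 (Fintype.linearIndependent_iff.1
    (linearIndependent_iotaVec_curveVec v hw θ (minpoly.natDegree_le θ)) _ hι i)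

end Independence

section Conditions

open IntermediateField

variable {F K : Type*} [Field F] [Field K] [Algebra F K]

variable (F) in
/-- The linear map whose image is the `k`-space `⟨(v, 1), F(θ) w⟩` containing the representation of
`affineSubline F v w θ`, where `k = [F(θ) : F]`. -/
def curveSpaceMap (v w : K × K) (θ : K) : F × F⟮θ⟯ →ₗ[F] K × K × F where
  toFun p := p.1 • affVec F v + infVec F ((p.2 : K) • w)
  map_add' p p' := by
    simp only [Prod.fst_add, Prod.snd_add, AddMemClass.coe_add, add_smul, map_add]
    abel
  map_smul' c p := by
    simp only [Prod.smul_fst, Prod.smul_snd, coe_smul, smul_assoc, map_smul, smul_add,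
      RingHom.id_apply]

theorem curveSpaceMap_last (v w : K × K) (θ : K) (p : F × F⟮θ⟯) :
    (curveSpaceMap F v w θ p).2.2 = p.1 := by
  simp [curveSpaceMap, affVec, infVec]

theorem curveSpaceMap_injective (v : K × K) {w : K × K} (hw : w ≠ 0) (θ : K) :
    Function.Injective (curveSpaceMap F v w θ) := by
  rw [← LinearMap.ker_eq_bot, LinearMap.ker_eq_bot']
  intro p hp
  have h1 : p.1 = 0 := by rw [← curveSpaceMap_last v w θ p, hp]; rfl
  have h2 : infVec F ((p.2 : K) • w) = 0 := by
    rwa [curveSpaceMap, LinearMap.coe_mk, AddHom.coe_mk, h1, zero_smul, zero_add] at hp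
  rw [map_eq_zero_iff _ infVec_injective, smul_eq_zero_iff_left hw] at h2
  exact Prod.ext h1 (Subtype.ext h2)

theorem image_affineSubline_subset_pts_range (v w : K × K) (θ : K) :
    affPt F '' affineSubline F v w θ ⊆ pts F (LinearMap.range (curveSpaceMap F v w θ)) := by
  have h (y : F⟮θ⟯) : affPt F (v + (y : K) • w) ∈
      pts F (LinearMap.range (curveSpaceMap F v w θ)) := by
    refine ((isPt_affPt _).mem_pts_iff _).2 ⟨(1, y), ?_⟩
    simp [curveSpaceMap, affVec, infVec]
  rintro _ ⟨_, rfl | ⟨t, rfl⟩, rfl⟩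
  · simpa using h 0
  · exact h (algebraMap F F⟮θ⟯ t - AdjoinSimple.gen F θ)⁻¹

variable [Fintype F] [Finite K]

theorem pts_range_inter_hInf_mem_subspread (v : K × K) {w : K × K} (hw : w ≠ 0) (θ : K) :
    pts F (LinearMap.range (curveSpaceMap F v w θ)) ∩ hInf F K ∈
      subspread F K (minpoly F θ).natDegree := by
  have hinf (y : F⟮θ⟯) : curveSpaceMap F v w θ (0, y) = (w.1 * y, w.2 * y, 0) := by
    simp [curveSpaceMap, infVec, mul_comm]
  refine ⟨w.1, w.2, hw, Set.ext fun R => ⟨?_, ?_⟩⟩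
  · obtain ⟨u, hu⟩ := exists_isPt R
    rw [Set.mem_inter_iff, hu.mem_pts_iff, hu.mem_hInf_iff]
    rintro ⟨⟨⟨c, y⟩, rfl⟩, h0⟩
    obtain rfl : c = 0 := by rwa [curveSpaceMap_last] at h0
    refine ⟨y, (mem_adjoin_simple_iff_pow_eq_self θ).1 y.2, fun hy => hu.ne_zero ?_, hinf y ▸ hu⟩
    rw [hinf, hy, mul_zero, mul_zero]
    rfl
  · rintro ⟨y, hy, -, hR⟩
    rw [Set.mem_inter_iff, hR.mem_pts_iff, hR.mem_hInf_iff]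
    exact ⟨⟨(0, ⟨y, (mem_adjoin_simple_iff_pow_eq_self θ).2 hy⟩), hinf _⟩, rfl⟩

theorem condI_image_affineSubline (v : K × K) {w : K × K} (hw : w ≠ 0) {θ : K}
    (hθ : θ ∉ (algebraMap F K).fieldRange) (hq : (minpoly F θ).natDegree ≤ Nat.card F) :
    CondI F K (minpoly F θ).natDegree (affPt F '' affineSubline F v w θ) := by
  have hint := Algebra.IsIntegral.isIntegral (R := F) θ
  have hnrc : IsNRC F (minpoly F θ).natDegree (affPt F '' affineSubline F v w θ) :=
    isNRC_iff.2 ⟨(minpoly.two_le_natDegree_iff hint).2 hθ, hq, _,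
      linearIndependent_curveVec v hw θ, (nrc_curveVec hint hθ v w).symm⟩
  refine ⟨hnrc, _, ?_, image_affineSubline_subset_pts_range v w θ,
    pts_range_inter_hInf_mem_subspread v hw θ⟩
  rw [LinearMap.finrank_range_of_inj (curveSpaceMap_injective v hw θ), Module.finrank_prod,
    Module.finrank_self, adjoin.finrank hint, add_comm]

end Conditions

section IndicatorSet

open Polynomial

variable {F K : Type*} [Field F] [Fintype F] [Field K] [Algebra F K] {n : ℕ} [NeZero n]

theorem image_iota_nrc_subset {d : ℕ} (e : Fin (d + 1) → K × K × F) :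
    iota F K n '' nrc F e ⊆ nrc K (iotaVec F K n ∘ e) := by
  rintro _ ⟨P, ⟨p, hp⟩, rfl⟩
  exact ⟨_, iotaVec_nrcVec (n := n) e p ▸ hp.iota⟩

theorem IsPt.last_eq_zero_of_mem_indicatorPoints {k : ℕ} (hkn : k ∣ n) {x : VStar K n}
    {P : SigStar K n} (h : IsPt x P) (hP : P ∈ indicatorPoints F K n k) : x.2.2 = 0 := by
  obtain ⟨r, y, hy, hyP⟩ := exists_mem_classSpace_of_mem_indicatorPoints hkn hP
  obtain ⟨c, -, rfl⟩ := hyP.iff_exists_smul.1 h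
  exact (Submodule.smul_mem _ c hy).1

variable [Finite K]

theorem IsPt.injOn_sigma_iterate_conjVec (hn : Module.finrank F K = n) {k : ℕ} (hkn : k ∣ n)
    {w : K × K} {Q : SigStar K n} (hQ : IsPt (conjVec F n k w 0) Q) :
    Set.InjOn (fun j => (sigma F K n)^[j] Q) (Set.Iio k) := by
  intro i hi j hj (h : (sigma F K n)^[i] Q = (sigma F K n)^[j] Q)
  have hQi := hQ.sigma_iterate_conjVec hn hkn i
  have hQj := hQ.sigma_iterate_conjVec hn hkn j
  obtain ⟨c, -, hc⟩ := hQi.iff_exists_smul.1 (h ▸ hQj)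
  have hmem : conjVec F n k w j ∈ classSpace K n k i :=
    hc ▸ Submodule.smul_mem _ c (conjVec_mem_classSpace w i)
  exact (modEq_of_mem_classSpace hQj.ne_zero hmem (conjVec_mem_classSpace w j)).eq_of_lt_of_lt hi hj

theorem IsPt.mem_indicatorSpace_conjVec (hn : Module.finrank F K = n) {k : ℕ} (hkn : k ∣ n)
    {w : K × K} {Q : SigStar K n} (hQ : IsPt (conjVec F n k w 0) Q) :
    Q ∈ indicatorSpace F K n k := by
  refine ⟨(hQ.mem_pts_iff _).2 (conjVec_mem_span_sigmaVec_nu hkn w), ?_⟩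
  have h := hQ.sigma_iterate_conjVec hn hkn k
  rw [conjVec_self] at h
  exact h.unique hQ

variable (v : K × K) {w : K × K} (θ : K)

theorem nrc_inter_indicatorPoints (hn : Module.finrank F K = n)
    (hkn : (minpoly F θ).natDegree ∣ n) {Q : SigStar K n}
    (hQ : IsPt (conjVec F n (minpoly F θ).natDegree w 0) Q) :
    nrc K (iotaVec F K n ∘ curveVec F v w θ) ∩ indicatorPoints F K n (minpoly F θ).natDegree =
      (fun j => (sigma F K n)^[j] Q) '' Set.Iio (minpoly F θ).natDegree := by
  have hint := Algebra.IsIntegral.isIntegral (R := F) θ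
  have hpow {j : ℕ} {P : SigStar K n} :
      IsPt (nrcVec (iotaVec F K n ∘ curveVec F v w θ) (1, θ ^ Fintype.card F ^ j)) P ↔
        P = (sigma F K n)^[j] Q := by
    rw [nrcVec_iotaVec_curveVec_pow,
      isPt_smul_iff (pow_ne_zero _ (aeval_derivative_minpoly_ne_zero hint))]
    have hj := hQ.sigma_iterate_conjVec hn hkn j
    exact ⟨fun h => h.unique hj, fun h => h ▸ hj⟩
  ext P
  constructor
  · rintro ⟨hP, hP'⟩
    obtain h | ⟨t, h⟩ := mem_nrc_iff.1 hP
    · have h0 := h.last_eq_zero_of_mem_indicatorPoints hkn hP'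
      rw [Function.comp_apply, curveVec_last hint] at h0
      exact absurd ((map_eq_zero (algebraMap F K)).1 h0) one_ne_zero
    · have h0 := h.last_eq_zero_of_mem_indicatorPoints hkn hP'
      rw [nrcVec_iotaVec_curveVec hint] at h0
      obtain ⟨j, hj, rfl⟩ := aeval_minpoly_eq_zero_iff.1 (show aeval t (minpoly F θ) = 0 by
        simpa [iotaVec, affVec] using h0)
      exact ⟨j, hj, (hpow.1 h).symm⟩
  · rintro ⟨j, hj, rfl⟩
    exact ⟨mem_nrc_iff.2 (Or.inr ⟨_, hpow.2 rfl⟩),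
      Set.mem_biUnion hj ⟨Q, hQ.mem_indicatorSpace_conjVec hn hkn, rfl⟩⟩

theorem condII_image_affineSubline (hn : Module.finrank F K = n) (hw : w ≠ 0)
    (hθ : θ ∉ (algebraMap F K).fieldRange) (hkn : (minpoly F θ).natDegree ∣ n)
    (hq : (minpoly F θ).natDegree ≤ Nat.card F) :
    CondII F K n (minpoly F θ).natDegree (affPt F '' affineSubline F v w θ) := by
  have hint := Algebra.IsIntegral.isIntegral (R := F) θ
  have hle := Nat.le_of_dvd (NeZero.pos n) hkn
  have hq' : (minpoly F θ).natDegree ≤ Nat.card K :=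
    hq.trans (Nat.card_le_card_of_injective _ (algebraMap F K).injective)
  have hnrc : IsNRC K (minpoly F θ).natDegree (nrc K (iotaVec F K n ∘ curveVec F v w θ)) :=
    isNRC_iff.2 ⟨(minpoly.two_le_natDegree_iff hint).2 hθ, hq', _,
      linearIndependent_iotaVec_curveVec v hw θ hle, rfl⟩
  have hne : conjVec F n (minpoly F θ).natDegree w 0 ≠ 0 :=
    (linearIndependent_conjVec hle hw).ne_zero ⟨0, minpoly.natDegree_pos hint⟩
  have hQ := isPt_mk (k := K) hne
  exact ⟨_, ⟨hnrc, nrc_curveVec hint hθ v w ▸ image_iota_nrc_subset _⟩, _,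
    hQ.injOn_sigma_iterate_conjVec hn hkn, nrc_inter_indicatorPoints v θ hn hkn hQ⟩

end IndicatorSet

open IntermediateField in
theorem exists_isSmallestTangentSubline {F K : Type*} [Field F] [Fintype F] [Field K] [Algebra F K]
    [Finite K] (v : K × K) {w : K × K} (hw : w ≠ 0) (θ : K) :
    ∃ m', IsSmallestTangentSubline
      (subline (algebraMap F K).fieldRange (poleVec v w θ) (affVec K v)) m' ∧
        IsSubline K (Fintype.card F ^ (minpoly F θ).natDegree) m' := by
  have hmin (M : Subfield K) (hM : (algebraMap F K).fieldRange ≤ M) (hθ : θ ∈ M) :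
      F⟮θ⟯.toSubfield ≤ M :=
    adjoin_simple_le_iff (K := M.toIntermediateField fun c => hM ⟨c, rfl⟩).2 hθ
  refine ⟨_, isSmallestTangentSubline_subline v hw ?_ (mem_adjoin_simple_self F θ) hmin,
    isSubline_iff.2 ⟨_, card_toSubfield_adjoin_simple θ, _, _,
      linearIndependent_poleVec_affVec v hw θ, rfl⟩⟩
  rintro _ ⟨c, rfl⟩
  exact F⟮θ⟯.algebraMap_mem c

end ABB

end

theorem theorem2p6 (F K : Type*) [Field F] [Fintype F] [Field K] [Algebra F K]
    (q n : ℕ) [NeZero n] (hq : Fintype.card F = q) (hn : Module.finrank F K = n) (hqn : n ≤ q) :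
    (∀ C : Set (ABB.Sig F K),
      (∃ m : Set (ABB.Plane K), ABB.IsSubline K q m ∧ ABB.External m ∧ C = ABB.abbImage F K m) ↔
        ∃ k : ℕ, k ∣ n ∧ ABB.CondI F K k C ∧ ABB.CondII F K n k C) ∧
    (∀ (m : Set (ABB.Plane K)) (k : ℕ), ABB.IsSubline K q m → ABB.External m → k ∣ n →
      ABB.CondI F K k (ABB.abbImage F K m) → ABB.CondII F K n k (ABB.abbImage F K m) →
      ∃ m' : Set (ABB.Plane K),
        ABB.IsSmallestTangentSubline m m' ∧ ABB.IsSubline K (q ^ k) m') := by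
  subst hq
  have : Module.Finite F K := Module.finite_of_finrank_pos (hn ▸ NeZero.pos n)
  have : Finite K := Module.finite_of_finite F
  have hdvd (θ : K) : (minpoly F θ).natDegree ∣ n :=
    hn ▸ minpoly.degree_dvd (Algebra.IsIntegral.isIntegral θ)
  have hle (θ : K) : (minpoly F θ).natDegree ≤ Nat.card F :=
    Nat.card_eq_fintype_card (α := F) ▸ (Nat.le_of_dvd (NeZero.pos n) (hdvd θ)).trans hqn
  constructor
  · intro C
    rw [← Nat.card_eq_fintype_card, ABB.exists_external_iff]
    constructor
    · rintro ⟨v, w, θ, hw, hθ, rfl⟩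
      exact ⟨_, hdvd θ, ABB.condI_image_affineSubline v hw hθ (hle θ),
        ABB.condII_image_affineSubline v θ hn hw hθ (hdvd θ) (hle θ)⟩
    · rintro ⟨k, hkn, h1, h2⟩
      exact ABB.exists_affineSubline_of_cond hn hkn h1 h2
  · intro m k hm hext _ h1 _
    rw [← Nat.card_eq_fintype_card] at hm
    obtain ⟨v, w, θ, hw, hθ, rfl⟩ := ABB.exists_eq_subline_of_external hm hext
    rw [ABB.subline_eq_image_affPt hθ, ABB.abbImage_image_affPt] at h1
    rw [h1.1.degree_unique (ABB.condI_image_affineSubline v hw hθ (hle θ)).1]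
    exact ABB.exists_isSmallestTangentSubline v hw θ
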